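/- **Setting.** An instance is a connected $n$-node graph $G$ whose nodes have identifiers $0,\dots,n-1$; every node knows its identifier, its neighbours, the identifier of its parent in some spanning tree of $G$ rooted at node $0$, a pattern graph $H$ with $k\ge 2$ nodes, and a natural number $\Delta$. The language $\textsc{subgraph-counting}(H)$ consists of the instances in which the number of copies of $H$ in $G$ is exactly $\Delta$ (copies may be understood as subgraphs of $G$ isomorphic to $H$, or as induced subgraphs isomorphic to $H$; the theorem holds for both). $\mathcal C[T,B]$ is the class of (randomized) distributed algorithms that run for $T$ synchronous rounds in which neighbours exchange messages of at most $B$ bits. In an $(r,\ell,\mathcal A)$-distributed interactive proof, the nodes and an unbounded randomized prover alternate for $r$ rounds, the last one being the prover's; in a prover's round the prover sends $\ell$ bits to each node, and in a verifier's round each node sends $\ell$ bits to the prover, as a function of its input, its private coins and its messages so far. Then the nodes, without the prover, run a verification algorithm from $\mathcal A$, after which each of them accepts or rejects. A language $\mathcal L$ is in $\mathrm{dStatZK}[r,\ell,\mathcal A]$ if there are such a proof system, an honest prover and a simulator $S\in\mathcal A$ such that - (completeness) on every instance in $\mathcal L$, with the honest prover, all nodes accept with probability at least $2/3$; - (soundness)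 on every instance not in $\mathcal L$ and for every prover, all nodes accept with probability at most $1/3$; - (statistical zero-knowledge) for every polynomial $p$, all sufficiently large $n$, every $n$-node instance in $\mathcal L$ and every node $v$, the output of $S$ at $v$ is within total variation distance $1/p(n)$ of the view of $v$ in the interaction with the honest prover, where the view consists of the coins of $v$, its messages to and from the prover, and all messages received from its neighbours. **Theorem.** Let $k=k(n)\ge 2$, let $H=H_n$ be a graph with $k$ nodes, and let $q=q(n)$ be primes such that either $k\in\mathcal O(1)$ and $q\in n^{\omega(1)}$, or $k\in\omega(1)$ and $q>n^k$. Then $$\textsc{subgraph-counting}(H)\in \mathrm{dStatZK}\left[\mathcal O(k\log k+\log\log n),\ \mathcal O\left(\frac{\log^2 q}{\log k}+k\log k\log q\right),\ \mathcal C\left[\mathcal O(1),\,k\cdot\mathrm{polylog}(n,k)\right]\right],$$ where the constants in the $\mathcal O$'s and in the $\mathrm{polylog}$ are absolute and the bounds hold for all sufficiently large $n$. In particular, for $k\in\mathcal O(1)$ the number of rounds is $\mathcal O(\log\log n)$. -/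

import Mathlib

open Filter

namespace DistZK

noncomputable section

/-! ### Probability over a uniform finite sample space -/

open Classical in
/-- Probability of the event `E` when `ω` is uniform on the finite set `Ω`. -/
def prob {Ω : Type} [Fintype Ω] (E : Ω → Prop) : ℝ :=
  ((Finset.univ.filter E).card : ℝ) / (Fintype.card Ω : ℝ)

/-- Total variation distance between the laws of two random variables `X`, `Y`, each defined on
its own uniform finite sample space: the supremum over all events `A` of the difference of the
probabilities of `A`. -/
def tvDist {Ω Ω' α : Type} [Fintype Ω] [Fintype Ω'] (X : Ω → α) (Y : Ω' → α) : ℝ :=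
  ⨆ A : Set α, |prob (fun ω => X ω ∈ A) - prob (fun ω => Y ω ∈ A)|

/-- A message of `b` bits. -/
abbrev Bits (b : ℕ) : Type := Fin b → Bool

/-! ### Networks and inputs -/

/-- An `n`-node network with its inputs. The vertex `v : Fin n` is the node with identifier `v`.
Every node is given its own identifier, the identifier of its parent in a spanning tree rooted at
the node with identifier `0` (the root is, by convention, its own parent), and the number
`target`. -/
structure Instance (n : ℕ) where
  graph : SimpleGraph (Fin n)
  connected : graph.Connected
  parent : Fin n → Fin n
  parent_root : ∀ v : Fin n, v.val = 0 → parent v = v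
  parent_adj : ∀ v : Fin n, v.val ≠ 0 → graph.Adj v (parent v)
  parent_reaches_root : ∀ v : Fin n, ∃ m : ℕ, (parent^[m] v).val = 0
  target : ℕ

/-- What a node knows before any communication: its identifier, the identifiers of its neighbours,
the identifier of its parent, and the number `target`. -/
structure LocalInput (n : ℕ) where
  id : Fin n
  nbrs : Set (Fin n)
  parent : Fin n
  target : ℕ

/-- The local input of the node `v`. -/
def Instance.localInput {n : ℕ} (I : Instance n) (v : Fin n) : LocalInput n where
  id := v
  nbrs := I.graph.neighborSet v
  parent := I.parent v
  target := I.target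

/-- A distributed language: for every number `n` of nodes, a set of `n`-node instances. -/
abbrev Language : Type := ∀ n : ℕ, Set (Instance n)

/-! ### Distributed algorithms -/

/-- What a node receives from its neighbours: for each elapsed round, the `B`-bit message that came
from each neighbour (`none` for nodes that are not neighbours). -/
abbrev Inbox (n B : ℕ) : Type := List (Fin n → Option (Bits B))

/-- A distributed algorithm with `T` synchronous rounds and `B`-bit messages on every edge and in
each direction per round. A node with local data `x : In` and messages `m` received so far sends
`send x m u` to its neighbour `u`; after round `T` it outputs `output x m`. Randomness, where it is
used, is part of the local data. -/
structure DistAlg (n T B : ℕ) (In Out : Type) where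
  send : In → Inbox n B → Fin n → Bits B
  output : In → Inbox n B → Out

namespace DistAlg

variable {n T B : ℕ} {In Out : Type}

open Classical in
/-- The messages received by each node in the first `t` rounds on the graph `G`. -/
def inbox (A : DistAlg n T B In Out) (G : SimpleGraph (Fin n)) (x : Fin n → In) :
    ℕ → Fin n → Inbox n B
  | 0 => fun _ => []
  | t + 1 => fun v =>
      A.inbox G x t v ++
        [fun u => if G.Adj u v then some (A.send (x u) (A.inbox G x t u) v) else none]

/-- The output of the node `v` after all `T` rounds. -/
def run (A : DistAlg n T B In Out) (G : SimpleGraph (Fin n)) (x : Fin n → In) (v : Fin n) : Out :=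
  A.output (x v) (A.inbox G x T v)

end DistAlg

/-! ### Distributed interactive proofs -/

/-- The verifier of a distributed interactive proof with `r` rounds of interaction and `l`-bit
messages, whose verification algorithm has `T` rounds and `B`-bit messages. Every node has private
random coins, uniform on the finite set `Coin` and independent of those of the other nodes.
In a verifier's round, a node sends to the prover a message that depends on its local input, its
coins, and the messages that it has exchanged with the prover so far (`respond`). After the
interaction the nodes run `verify`, where the local data of a node are its local input, its coins
and all its messages to and from the prover; the output `true` means `accept`. -/
structure Verifier (n r l T B : ℕ) where
  Coin : Type
  [coinFintype : Fintype Coin]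
  [coinNonempty : Nonempty Coin]
  respond : LocalInput n → Coin → List (Bits l) → Bits l
  verify : DistAlg n T B (LocalInput n × Coin × List (Bits l)) Bool

attribute [instance] Verifier.coinFintype Verifier.coinNonempty

/-- A prover, computationally unbounded and randomized. In a prover's round it sends an `l`-bit
message to each node, depending on its own coins and on all messages exchanged so far between it
and all the nodes. -/
structure Prover (n l : ℕ) where
  Coin : Type
  [coinFintype : Fintype Coin]
  [coinNonempty : Nonempty Coin]
  next : Coin → List (Fin n → Bits l) → Fin n → Bits l

attribute [instance] Prover.coinFintype Prover.coinNonempty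

/-- The view of a node: its private coins, all messages that it exchanged with the prover, and all
messages that it received from its neighbours during the verification algorithm. -/
structure View (n l B : ℕ) (Coin : Type) where
  coin : Coin
  interaction : List (Bits l)
  inbox : Inbox n B

namespace Verifier

variable {n r l T B : ℕ}

/-- The sample space of an execution: the coins of all nodes and those of the prover. -/
abbrev Sample (V : Verifier n r l T B) (P : Prover n l) : Type := (Fin n → V.Coin) × P.Coin

open Classical in
/-- The messages of the first `i` rounds of interaction, oldest first; the entry of a round gives,
for each node, the message sent by or to that node. The two sides alternate so that round `r`, the
last one, is a prover's round. -/
def interact (V : Verifier n r l T B) (P : Prover n l) (I : Instance n) (ω : V.Sample P) :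
    ℕ → List (Fin n → Bits l)
  | 0 => []
  | i + 1 =>
      V.interact P I ω i ++
        [if Odd (r - i) then P.next ω.2 (V.interact P I ω i)
         else fun v => V.respond (I.localInput v) (ω.1 v) ((V.interact P I ω i).map fun m => m v)]

/-- The messages exchanged between the prover and the node `v` in all `r` rounds. -/
def nodeInteraction (V : Verifier n r l T B) (P : Prover n l) (I : Instance n) (ω : V.Sample P)
    (v : Fin n) : List (Bits l) :=
  (V.interact P I ω r).map fun m => m v

/-- The local data of the node `v` at the start of the verification algorithm. -/
def verifyInput (V : Verifier n r l T B) (P : Prover n l) (I : Instance n) (ω : V.Sample P)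
    (v : Fin n) : LocalInput n × V.Coin × List (Bits l) :=
  (I.localInput v, ω.1 v, V.nodeInteraction P I ω v)

/-- The probability that all nodes accept. -/
def acceptProb (V : Verifier n r l T B) (P : Prover n l) (I : Instance n) : ℝ :=
  prob fun ω : V.Sample P =>
    ∀ v : Fin n, V.verify.run I.graph (V.verifyInput P I ω) v = true

/-- The view of the node `v`, as a random variable. -/
def view (V : Verifier n r l T B) (P : Prover n l) (I : Instance n) (v : Fin n)
    (ω : V.Sample P) : View n l B V.Coin where
  coin := ω.1 v
  interaction := V.nodeInteraction P I ω v
  inbox := V.verify.inbox I.graph (V.verifyInput P I ω) T v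

end Verifier

/-- A simulator: a randomized distributed algorithm, without any prover, with `T` rounds and `B`-bit
messages. -/
structure Simulator (n T B : ℕ) (Out : Type) where
  Coin : Type
  [coinFintype : Fintype Coin]
  [coinNonempty : Nonempty Coin]
  alg : DistAlg n T B (LocalInput n × Coin) Out

attribute [instance] Simulator.coinFintype Simulator.coinNonempty

/-- The output of the simulator at the node `v`, as a random variable. -/
def Simulator.out {n T B : ℕ} {Out : Type} (S : Simulator n T B Out) (I : Instance n) (v : Fin n)
    (ω : Fin n → S.Coin) : Out :=
  S.alg.run I.graph (fun u => (I.localInput u, ω u)) v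

/-- The class of languages with a distributed statistical zero-knowledge proof with `r n` rounds of
interaction, `l n`-bit messages, and with verification algorithm and simulator both having `T`
rounds and `B n`-bit messages, on `n`-node networks.
The honest prover is the one of the completeness condition, and zero-knowledge is required on the
instances in the language: the total variation distance between the simulated and the real view
of each node is eventually below every inverse power of `n`. -/
def DStatZK (r l : ℕ → ℕ) (T : ℕ) (B : ℕ → ℕ) : Set Language :=
  {L | ∃ (V : ∀ n, Verifier n (r n) (l n) T (B n))
      (P : ∀ n, Instance n → Prover n (l n))
      (S : ∀ n, Simulator n T (B n) (View n (l n) (B n) (V n).Coin)),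
      -- completeness
      (∀ n, ∀ I ∈ L n, 2 / 3 ≤ (V n).acceptProb (P n I) I) ∧
      -- soundness
      (∀ n, ∀ I ∉ L n, ∀ P' : Prover n (l n), (V n).acceptProb P' I ≤ 1 / 3) ∧
      -- statistical zero-knowledge
      (∀ c : ℕ, ∀ᶠ n : ℕ in atTop, ∀ I ∈ L n, ∀ v : Fin n,
        tvDist ((S n).out I v) ((V n).view (P n I) I v) ≤ 1 / (n : ℝ) ^ c)}

/-! ### Subgraph counting -/

/-- Which copies of the pattern are counted. -/
inductive CopyKind
  | subgraph
  | inducedSubgraph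

/-- The number of copies of `H` in `G`: of subgraphs of `G` isomorphic to `H`, or of vertex sets on
which `G` induces a graph isomorphic to `H`. -/
def numCopies {n k : ℕ} (κ : CopyKind) (H : SimpleGraph (Fin k)) (G : SimpleGraph (Fin n)) : ℕ :=
  match κ with
  | .subgraph => G.copyCount H
  | .inducedSubgraph => Nat.card {s : Set (Fin n) // Nonempty (H ≃g G.induce s)}

/-- The language of the instances in which the number of copies of the pattern (on networks with `n`
nodes, the `k n`-node graph `H n`) is exactly the number `target` given to the nodes. -/
def subgraphCounting (κ : CopyKind) (k : ℕ → ℕ) (H : ∀ n, SimpleGraph (Fin (k n))) : Language :=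
  fun n => {I | numCopies κ (H n) I.graph = I.target}

end

end DistZK

/-!
The number of copies of `H` is determined by the number of labelled copies, which is `|Aut H|` times
as large, at most `n ^ k`, and a sum `∑ w, ∏ a < b, M a b (w a) (w b)` over `w : Fin k → Fin n`,
where every row of the 0/1 matrices `M a b` is known to a node. Over a prime field `F` of size more
than `5 k² (n + 2) ^ k`, whose elements serve as names `α v` of the nodes, extend every `M a b` to a
polynomial of low degree in two variables, and add a random multiple of `N(x) N(y)`, where
`N(x) = ∏ v, (x - α v)`. This mask does not change the values at the nodes, but since the challenges
avoid the nodes, the values at the challenges become uniform. The sum-check protocol with `k` rounds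
reduces the sum to one value of each of these polynomials.

No node may see a coefficient of a polynomial sent in a round of sum-check. So every coefficient is
split into two random shares, one for the node in charge of it and one for the preceding node in the
cyclic order. All the equations to be checked are linear in the shares. The prover proves a random
linear combination of them with subtree sums along the spanning tree, hidden by a random summand at
every node. The challenges are coins of the root, which the prover repeats to the other nodes;
neighbours compare the last challenge and the value at it of a polynomial with the others as
coefficients.

For fixed challenges, what a node sees is the image of the coins of the prover under a bijection, so
that a simulator that samples these coins is perfect for `n ≥ 2`.
-/

namespace DistZK

open Function

/-! ### Labelled and unlabelled copies -/

section Copies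

variable {V W : Type*}

theorem card_eq_mul_card_of_card_fiber_eq {X Y : Type*} [Finite X] [Finite Y] (f : X → Y) (m : ℕ)
    (h : ∀ y, Nat.card {x // f x = y} = m) : Nat.card X = m * Nat.card Y := by
  have := Fintype.ofFinite Y
  rw [← Nat.card_congr (Equiv.sigmaFiberEquiv f), Nat.card_sigma]
  simp [h, mul_comm]

theorem card_iso_eq_card_aut {H : SimpleGraph V} {G : SimpleGraph W} (e : H ≃g G) :
    Nat.card (H ≃g G) = Nat.card (H ≃g H) :=
  Nat.card_congr (RelIso.relIsoCongr (.refl _) e.symm)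

theorem card_copy [Finite V] [Finite W] (H : SimpleGraph V) (G : SimpleGraph W) :
    Nat.card (H.Copy G) =
      Nat.card (H ≃g H) * Nat.card {S : G.Subgraph // Nonempty (H ≃g S.coe)} := by
  have : Finite (H.Copy G) := DFunLike.finite _
  refine card_eq_mul_card_of_card_fiber_eq
    (fun f => (⟨f.toSubgraph, ⟨f.isoToSubgraph⟩⟩ : {S : G.Subgraph // Nonempty (H ≃g S.coe)}))
    _ ?_
  rintro ⟨S, ⟨e⟩⟩
  rw [← card_iso_eq_card_aut e]
  let copyOfIso (e' : H ≃g S.coe) : H.Copy G :=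
    ⟨S.hom.comp e'.toHom, SimpleGraph.Subgraph.hom_injective.comp e'.injective⟩
  have toSubgraph_copyOfIso (e' : H ≃g S.coe) : (copyOfIso e').toSubgraph = S := by
    simp [copyOfIso, SimpleGraph.Copy.toSubgraph, SimpleGraph.Subgraph.map_comp]
  symm
  refine Nat.card_congr (Equiv.ofBijective
    (fun e' => ⟨copyOfIso e', Subtype.ext (toSubgraph_copyOfIso e')⟩) ⟨fun e₁ e₂ h => ?_, ?_⟩)
  · ext x
    exact congrArg (fun c : H.Copy G => c x) (congrArg Subtype.val h)
  · rintro ⟨f, hf⟩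
    obtain rfl : f.toSubgraph = S := congrArg Subtype.val hf
    exact ⟨f.isoToSubgraph, rfl⟩

theorem card_embedding [Finite V] [Finite W] (H : SimpleGraph V) (G : SimpleGraph W) :
    Nat.card (H ↪g G) =
      Nat.card (H ≃g H) * Nat.card {s : Set W // Nonempty (H ≃g G.induce s)} := by
  have : Finite (H ↪g G) := DFunLike.finite _
  refine card_eq_mul_card_of_card_fiber_eq
    (fun f : H ↪g G =>
      (⟨Set.range f, ⟨f.isoInduceRange⟩⟩ : {s : Set W // Nonempty (H ≃g G.induce s)}))
    _ ?_
  rintro ⟨s, ⟨e⟩⟩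
  rw [← card_iso_eq_card_aut e]
  let embeddingOfIso (e' : H ≃g G.induce s) : H ↪g G :=
    (SimpleGraph.Embedding.induce s).comp e'.toEmbedding
  have range_embeddingOfIso (e' : H ≃g G.induce s) : Set.range (embeddingOfIso e') = s := by
    ext x
    exact ⟨fun ⟨y, hy⟩ => hy ▸ (e' y).2, fun hx => ⟨e'.symm ⟨x, hx⟩, by simp [embeddingOfIso]⟩⟩
  symm
  refine Nat.card_congr (Equiv.ofBijective
    (fun e' => ⟨embeddingOfIso e', Subtype.ext (range_embeddingOfIso e')⟩)
    ⟨fun e₁ e₂ h => ?_, ?_⟩)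
  · ext x
    exact congrArg (fun c : H ↪g G => c x) (congrArg Subtype.val h)
  · rintro ⟨f, hf⟩
    obtain rfl : Set.range f = s := congrArg Subtype.val hf
    exact ⟨f.isoInduceRange, rfl⟩

/-- The condition that a pair `a`, `b` of pattern vertices puts on the adjacency of their images. -/
def PairOk (κ : CopyKind) (H : SimpleGraph V) (a b : V) (adj : Prop) : Prop :=
  (H.Adj a b → adj) ∧ (κ = .inducedSubgraph → adj → H.Adj a b)

/-- `w` maps the pattern injectively onto a copy of it in `G`. -/
def IsLabelledCopy (κ : CopyKind) (H : SimpleGraph V) (G : SimpleGraph W) (w : V → W) : Prop :=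
  w.Injective ∧ ∀ a b, PairOk κ H a b (G.Adj (w a) (w b))

theorem isLabelledCopy_iff_forall_lt [LinearOrder V] {κ : CopyKind} {H : SimpleGraph V}
    {G : SimpleGraph W} {w : V → W} :
    IsLabelledCopy κ H G w ↔ ∀ a b, a < b → w a ≠ w b ∧ PairOk κ H a b (G.Adj (w a) (w b)) := by
  refine ⟨fun h a b hab => ⟨h.1.ne hab.ne, h.2 a b⟩, fun h => ⟨?_, fun a b => ?_⟩⟩
  · exact .of_lt_imp_ne fun a b hab => (h a b hab).1
  · rcases lt_trichotomy a b with hab | rfl | hba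
    · exact (h a b hab).2
    · exact ⟨fun h => (H.irrefl h).elim, fun _ h => (G.irrefl h).elim⟩
    · have := (h b a hba).2
      exact ⟨fun h => (this.1 h.symm).symm, fun h₁ h₂ => (this.2 h₁ h₂.symm).symm⟩

theorem card_isLabelledCopy {n k : ℕ} (κ : CopyKind) (H : SimpleGraph (Fin k))
    (G : SimpleGraph (Fin n)) :
    Nat.card {w : Fin k → Fin n // IsLabelledCopy κ H G w} =
      Nat.card (H ≃g H) * numCopies κ H G := by
  cases κ with
  | subgraph =>
    have numCopies_eq :
        numCopies .subgraph H G = Nat.card {S : G.Subgraph // Nonempty (H ≃g S.coe)} := by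
      simp only [numCopies, SimpleGraph.copyCount]
      exact (Nat.subtype_card _ (by simp)).symm
    rw [numCopies_eq, ← card_copy]
    exact Nat.card_congr
      { toFun := fun w => ⟨⟨w.1, fun {a b} h => (w.2.2 a b).1 h⟩, w.2.1⟩
        invFun := fun f => ⟨f, f.injective, fun a b => ⟨fun h => f.toHom.map_adj h, nofun⟩⟩ }
  | inducedSubgraph =>
    change _ = _ * Nat.card {s : Set (Fin n) // Nonempty (H ≃g G.induce s)}
    rw [← card_embedding]
    exact Nat.card_congr
      { toFun := fun w => ⟨⟨w.1, w.2.1⟩, fun {a b} => ⟨(w.2.2 a b).2 rfl, (w.2.2 a b).1⟩⟩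
        invFun := fun f => ⟨f, f.injective, fun a b =>
          ⟨fun h => f.map_adj_iff.2 h, fun _ h => f.map_adj_iff.1 h⟩⟩ }

theorem card_aut_mul_numCopies_le {n k : ℕ} (κ : CopyKind) (H : SimpleGraph (Fin k))
    (G : SimpleGraph (Fin n)) : Nat.card (H ≃g H) * numCopies κ H G ≤ n ^ k := by
  rw [← card_isLabelledCopy]
  exact (Finite.card_subtype_le _).trans_eq (by simp)

end Copies

/-! ### Uniform probability -/

section Probability

theorem sum_sum_update {ι α β : Type*} [Fintype ι] [DecidableEq ι] [Fintype α]
    [AddCommMonoid β] (g : (ι → α) → β) (i : ι) :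
    ∑ w, ∑ x, g (update w i x) = Fintype.card α • ∑ w, g w := by
  let swap : (ι → α) × α ≃ (ι → α) × α :=
    { toFun := fun y => (update y.1 i y.2, y.1 i)
      invFun := fun y => (update y.1 i y.2, y.1 i)
      left_inv := fun y => by simp
      right_inv := fun y => by simp }
  have sum_swap : ∑ y : (ι → α) × α, g (update y.1 i y.2) = ∑ y : (ι → α) × α, g y.1 :=
    Fintype.sum_equiv swap _ _ fun _ => rfl
  rw [← Fintype.sum_prod_type', sum_swap, Fintype.sum_prod_type]
  simp [Finset.smul_sum]

variable {Ω : Type} [Fintype Ω]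

open Classical in
theorem prob_eq_sum (E : Ω → Prop) :
    prob E = (∑ ω, if E ω then (1 : ℝ) else 0) / Fintype.card Ω := by
  simp [prob]

theorem prob_mono {E E' : Ω → Prop} (h : ∀ ω, E ω → E' ω) : prob E ≤ prob E' := by
  unfold prob
  gcongr with ω
  exact h ω

theorem prob_of_forall [Nonempty Ω] {E : Ω → Prop} (h : ∀ ω, E ω) : prob E = 1 := by
  have : (Fintype.card Ω : ℝ) ≠ 0 := by simp
  simp [prob, h, this]

theorem prob_or_le (E E' : Ω → Prop) : prob (fun ω => E ω ∨ E' ω) ≤ prob E + prob E' := by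
  classical
  simp only [prob, ← add_div]
  gcongr
  exact_mod_cast (Finset.card_le_card (fun ω => by simp)).trans (Finset.card_union_le _ _)

theorem prob_exists_le {ι : Type*} [Fintype ι] (E : ι → Ω → Prop) :
    prob (fun ω => ∃ i, E i ω) ≤ ∑ i, prob (E i) := by
  classical
  simp only [prob, ← Finset.sum_div]
  gcongr
  exact_mod_cast (Finset.card_le_card (fun ω => by simp)).trans Finset.card_biUnion_le

theorem prob_comp_bijective {Ω' : Type} [Fintype Ω'] (E : Ω' → Prop) {Φ : Ω → Ω'}
    (hΦ : Bijective Φ) : prob (fun ω => E (Φ ω)) = prob E := by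
  classical
  rw [prob_eq_sum, prob_eq_sum, Fintype.card_of_bijective hΦ,
    Fintype.sum_bijective Φ hΦ _ (fun ω => if E ω then (1 : ℝ) else 0) fun _ => rfl]

theorem prob_prod_le {Ω' : Type} [Fintype Ω'] [Nonempty Ω] [Nonempty Ω'] (E : Ω × Ω' → Prop)
    {δ : ℝ} (h : ∀ ω', prob (fun ω => E (ω, ω')) ≤ δ) : prob E ≤ δ := by
  classical
  have card_pos : (0 : ℝ) < Fintype.card Ω := by exact_mod_cast Fintype.card_pos
  simp only [prob_eq_sum, div_le_iff₀ card_pos] at h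
  have card_prod_pos : (0 : ℝ) < Fintype.card (Ω × Ω') := by exact_mod_cast Fintype.card_pos
  rw [prob_eq_sum, div_le_iff₀ card_prod_pos, Fintype.sum_prod_type_right]
  refine (Finset.sum_le_sum fun ω' _ => h ω').trans_eq ?_
  rw [Finset.sum_const, Finset.card_univ, nsmul_eq_mul, Fintype.card_prod, Nat.cast_mul]
  ring

variable {ι α : Type} [Fintype ι] [DecidableEq ι] [Fintype α] [Nonempty α]

theorem prob_eq_avg_update (E : (ι → α) → Prop) (i : ι) :
    prob E = (∑ w, prob fun x => E (update w i x)) / Fintype.card (ι → α) := by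
  classical
  have h := sum_sum_update (fun w => if E w then (1 : ℝ) else 0) i
  simp only [prob_eq_sum, ← Finset.sum_div, h, nsmul_eq_mul]
  field_simp

theorem prob_le_of_update (E : (ι → α) → Prop) (i : ι) {δ : ℝ}
    (h : ∀ w, prob (fun x => E (update w i x)) ≤ δ) : prob E ≤ δ := by
  have card_pos : (0 : ℝ) < Fintype.card (ι → α) := by exact_mod_cast Fintype.card_pos
  rw [prob_eq_avg_update E i, div_le_iff₀ card_pos]
  refine (Finset.sum_le_sum fun w _ => h w).trans_eq ?_
  rw [Finset.sum_const, Finset.card_univ, nsmul_eq_mul, mul_comm]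

theorem prob_comp_eval (E : α → Prop) (i : ι) : prob (fun w : ι → α => E (w i)) = prob E := by
  have card_ne : (Fintype.card (ι → α) : ℝ) ≠ 0 := by simp
  simp [prob_eq_avg_update (fun w : ι → α => E (w i)) i, card_ne, -Fintype.card_pi]

end Probability

/-! ### Public-coin protocols with typed messages -/

open Classical in
/-- The messages that `v` receives when every node `u` sends `msg u v` to its neighbour `v`. -/
noncomputable def deliver {n : ℕ} {E : Type} (G : SimpleGraph (Fin n)) (msg : Fin n → Fin n → E)
    (v u : Fin n) : Option E :=
  if G.Adj u v then some (msg u v) else none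

/-- The verifier of a public-coin protocol with `K` challenges in `R`, of which a node sees its own,
`K + 1` messages of the prover in `M`, one before and one after every challenge, and one round of
verification with messages in `E`. -/
structure PublicCoin (n K : ℕ) (R M E : Type) where
  send : LocalInput n → (Fin K → R) → (Fin (K + 1) → M) → Fin n → E
  accept : LocalInput n → (Fin K → R) → (Fin (K + 1) → M) → (Fin n → Option E) → Prop

/-- Binary encodings of the messages of a public-coin protocol. -/
structure Encodings (l B : ℕ) (R M E : Type) where
  challenge : R ↪ Bits l
  message : M ↪ Bits l
  edge : E ↪ Bits B

/-- A strategy of the prover is non-anticipating if its message at time `t` depends only on the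
challenges before `t`. -/
def NonAnticipating {K : ℕ} {R α : Type} (W : (Fin K → R) → Fin (K + 1) → α) : Prop :=
  ∀ c c' t, (∀ j : Fin K, j.castSucc < t → c j = c' j) → W c t = W c' t

namespace Verifier

variable {n r l T B : ℕ} (V : Verifier n r l T B) (P : Prover n l) (I : Instance n)
  (ω : V.Sample P)

open Classical in
/-- The message of round `j`. -/
noncomputable def roundMsg (j : ℕ) : Fin n → Bits l :=
  if Odd (r - j) then P.next ω.2 (V.interact P I ω j)
  else fun v => V.respond (I.localInput v) (ω.1 v) ((V.interact P I ω j).map fun m => m v)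

theorem interact_eq (i : ℕ) : V.interact P I ω i = (List.range i).map (V.roundMsg P I ω) := by
  induction i with
  | zero => rfl
  | succ i ih =>
    rw [List.range_succ, List.map_append, ← ih]
    rfl

theorem length_interact (i : ℕ) : (V.interact P I ω i).length = i := by
  simp [interact_eq]

end Verifier

namespace Encodings

variable {n K l B : ℕ} {R M E : Type} (ℰ : Encodings l B R M E)

/-- The messages between the prover and a node with coins `c` and prover messages `m`. -/
def transcript (c : Fin K → R) (m : Fin (K + 1) → M) : List (Bits l) :=
  List.ofFn fun j : Fin (2 * K + 1) =>
    if h : Even j.val then ℰ.message (m ⟨j / 2, by lia⟩) else ℰ.challenge (c ⟨j / 2, by grind⟩)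

/-- The view of a node with coins `c`, prover messages `m` and edge messages `inb`. -/
def nodeView (c : Fin K → R) (m : Fin (K + 1) → M) (inb : Fin n → Option E) :
    View n l B (Fin K → R) where
  coin := c
  interaction := ℰ.transcript c m
  inbox := [fun u => (inb u).map ℰ.edge]

/-- The prover messages contained in a transcript. -/
noncomputable def decode [Nonempty M] (h : List (Bits l)) (t : Fin (K + 1)) : M :=
  invFun ℰ.message (h.getD (2 * t) default)

/-- The edge messages of the only round contained in an inbox. -/
noncomputable def decodeInbox [Nonempty E] (m : Inbox n B) (u : Fin n) : Option E :=
  ((m.headD fun _ => none) u).map (invFun ℰ.edge)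

theorem decode_transcript [Nonempty M] (c : Fin K → R) (m : Fin (K + 1) → M) :
    ℰ.decode (ℰ.transcript c m) = m := by
  funext t
  have ht : 2 * t.val < 2 * K + 1 := by lia
  simp only [decode, transcript, List.getD, List.getElem?_ofFn, ht, dite_true, Option.getD_some,
    even_two_mul, Nat.mul_div_cancel_left _ two_pos]
  exact leftInverse_invFun ℰ.message.injective _

theorem decodeInbox_inbox_one [Nonempty E] {In Out : Type} (A : DistAlg n 1 B In Out)
    (G : SimpleGraph (Fin n)) (x : Fin n → In) (msg : Fin n → Fin n → E)
    (h : ∀ u v, A.send (x u) [] v = ℰ.edge (msg u v)) (v : Fin n) :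
    ℰ.decodeInbox (A.inbox G x 1 v) = deliver G msg v := by
  funext u
  by_cases huv : G.Adj u v
  · simp [decodeInbox, DistAlg.inbox, deliver, huv, h, leftInverse_invFun ℰ.edge.injective _]
  · simp [decodeInbox, DistAlg.inbox, deliver, huv]

end Encodings

namespace PublicCoin

variable {n K l B : ℕ} {R M E : Type}

/-- All nodes accept when the coins of the node `v` are `coins v` and the prover's messages are
`w`. -/
def AllAccept (Q : PublicCoin n K R M E) (I : Instance n) (coins : Fin n → Fin K → R)
    (w : Fin (K + 1) → Fin n → M) : Prop :=
  ∀ v, Q.accept (I.localInput v) (coins v) (fun t => w t v)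
    (deliver I.graph (fun u => Q.send (I.localInput u) (coins u) fun t => w t u) v)

variable [Nonempty R] [Nonempty M] [Nonempty E] {PC : Type} [Fintype PC] [Nonempty PC]

/-- The prover that follows the strategy `W`, where the challenges are the coins of the node
`root`. -/
noncomputable abbrev honest (ℰ : Encodings l B R M E) (root : Fin n)
    (W : PC → (Fin K → R) → Fin (K + 1) → Fin n → M) : Prover n l where
  Coin := PC
  next pc h v :=
    ℰ.message (W pc (fun j => invFun ℰ.challenge ((h.getD (2 * j.val + 1) default) root))
      (Fin.ofNat (K + 1) (h.length / 2)) v)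

variable [Fintype R]

open Classical in
/-- The verifier with binary messages. -/
noncomputable abbrev verifier (Q : PublicCoin n K R M E) (ℰ : Encodings l B R M E) :
    Verifier n (2 * K + 1) l 1 B where
  Coin := Fin K → R
  respond _ c h := if hh : h.length / 2 < K then ℰ.challenge (c ⟨_, hh⟩) else default
  verify :=
    { send := fun x _ u => ℰ.edge (Q.send x.1 x.2.1 (ℰ.decode x.2.2) u)
      output := fun x m => decide (Q.accept x.1 x.2.1 (ℰ.decode x.2.2) (ℰ.decodeInbox m)) }

section Rounds

variable (Q : PublicCoin n K R M E) (ℰ : Encodings l B R M E) (P : Prover n l) (I : Instance n)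

theorem roundMsg_even (ω : (Q.verifier ℰ).Sample P) (t : Fin (K + 1)) :
    (Q.verifier ℰ).roundMsg P I ω (2 * t) =
      P.next ω.2 ((Q.verifier ℰ).interact P I ω (2 * t)) :=
  if_pos ⟨K - t, by lia⟩

theorem roundMsg_odd (ω : (Q.verifier ℰ).Sample P) (t : Fin K) (v : Fin n) :
    (Q.verifier ℰ).roundMsg P I ω (2 * t + 1) v = ℰ.challenge (ω.1 v t) := by
  have not_odd : ¬ Odd (2 * K + 1 - (2 * t.val + 1)) :=
    Nat.not_odd_iff_even.2 ⟨K - t, by lia⟩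
  have half : (2 * t.val + 1) / 2 = t := by lia
  simp only [Verifier.roundMsg, if_neg not_odd, List.length_map, Verifier.length_interact, half,
    dif_pos t.isLt]

/-- The prover's messages in an execution. -/
noncomputable def proverMsg (ω : (Q.verifier ℰ).Sample P) (t : Fin (K + 1)) (v : Fin n) : M :=
  ℰ.decode ((Q.verifier ℰ).nodeInteraction P I ω v) t

theorem proverMsg_eq (ω : (Q.verifier ℰ).Sample P) (t : Fin (K + 1)) (v : Fin n) :
    Q.proverMsg ℰ P I ω t v = invFun ℰ.message
      (P.next ω.2 ((Q.verifier ℰ).interact P I ω (2 * t)) v) := by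
  have ht : 2 * t.val < 2 * K + 1 := by lia
  simp [proverMsg, Encodings.decode, Verifier.nodeInteraction, Verifier.interact_eq _ _ _ _
    (2 * K + 1), List.getD, ht, roundMsg_even]

theorem run_eq_true_iff (ω : (Q.verifier ℰ).Sample P) (v : Fin n) :
    (Q.verifier ℰ).verify.run I.graph ((Q.verifier ℰ).verifyInput P I ω) v = true ↔
      Q.accept (I.localInput v) (ω.1 v) (fun t => Q.proverMsg ℰ P I ω t v)
        (deliver I.graph (fun u => Q.send (I.localInput u) (ω.1 u)
          fun t => Q.proverMsg ℰ P I ω t u) v) := by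
  classical
  refine decide_eq_true_iff.trans (Eq.to_iff (congrArg _ ?_))
  exact ℰ.decodeInbox_inbox_one _ _ _ _ (fun _ _ => rfl) v

end Rounds

theorem interact_congr (Q : PublicCoin n K R M E) (ℰ : Encodings l B R M E) (P : Prover n l)
    (I : Instance n) (o o' : Fin n → Fin K → R) (pc : P.Coin) (i : ℕ)
    (h : ∀ v, ∀ j : Fin K, 2 * j.val + 1 < i → o v j = o' v j) :
    (Q.verifier ℰ).interact P I (o, pc) i = (Q.verifier ℰ).interact P I (o', pc) i := by
  induction i with
  | zero => rfl
  | succ i ih =>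
    have ih := ih fun v j hj => h v j (by lia)
    simp only [Verifier.interact, ih]
    congr 2
    split_ifs with hodd
    · rfl
    · funext v
      simp only [List.length_map, Verifier.length_interact]
      split_ifs with hK
      · rw [h v ⟨i / 2, hK⟩ (by grind)]
      · rfl

/-- To bound the acceptance probability, fix all coins but those of the root. -/
theorem acceptProb_le (Q : PublicCoin n K R M E) (ℰ : Encodings l B R M E) (I : Instance n)
    (root : Fin n) {δ : ℝ}
    (h : ∀ (o : Fin n → Fin K → R) (W : (Fin K → R) → Fin (K + 1) → Fin n → M),
      NonAnticipating W → prob (fun c => Q.AllAccept I (update o root c) (W c)) ≤ δ)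
    (P : Prover n l) :
    (Q.verifier ℰ).acceptProb P I ≤ δ := by
  refine prob_prod_le (Ω := Fin n → Fin K → R) _ fun pc =>
    prob_le_of_update (ι := Fin n) (α := Fin K → R) _ root fun o => ?_
  refine (prob_mono fun c hc v => (run_eq_true_iff Q ℰ P I _ v).1 (hc v)).trans
    (h o (fun c => Q.proverMsg ℰ P I (update o root c, pc)) fun c c' t hcc => ?_)
  funext v
  simp only [proverMsg_eq]
  rw [Q.interact_congr ℰ P I (update o root c) (update o root c')]
  intro u j hj
  by_cases hu : u = root
  · subst hu
    simpa using hcc j (by simp [Fin.lt_def]; lia)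
  · simp [hu]

section Honest

variable (Q : PublicCoin n K R M E) (ℰ : Encodings l B R M E) (I : Instance n) (root : Fin n)
  (W : PC → (Fin K → R) → Fin (K + 1) → Fin n → M) (hW : ∀ pc, NonAnticipating (W pc))

include hW

theorem honest_next_interact (ω : (Q.verifier ℰ).Sample (honest ℰ root W)) (t : Fin (K + 1))
    (v : Fin n) : (honest ℰ root W).next ω.2
        ((Q.verifier ℰ).interact (honest ℰ root W) I ω (2 * t)) v =
      ℰ.message (W ω.2 (ω.1 root) t v) := by
  have half : Fin.ofNat (K + 1) (2 * t.val / 2) = t := by ext; simp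
  simp only [Verifier.length_interact, half]
  congr 1
  refine congrFun (hW _ _ _ _ fun j hj => ?_) v
  have hj' : 2 * j.val + 1 < 2 * t.val := by simp [Fin.lt_def] at hj; lia
  simp only [Verifier.interact_eq, List.getD, List.getElem?_map, List.getElem?_range hj',
    Option.map_some, Option.getD_some]
  exact (congrArg _ (roundMsg_odd Q ℰ _ I ω j root)).trans
    (leftInverse_invFun ℰ.challenge.injective _)

theorem nodeInteraction_honest (ω : (Q.verifier ℰ).Sample (honest ℰ root W)) (v : Fin n) :
    (Q.verifier ℰ).nodeInteraction (honest ℰ root W) I ω v =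
      ℰ.transcript (ω.1 v) fun t => W ω.2 (ω.1 root) t v := by
  refine List.ext_getElem (by simp [Verifier.nodeInteraction, Verifier.length_interact,
    Encodings.transcript]) fun j hj _ => ?_
  replace hj : j < 2 * K + 1 := by
    simpa [Verifier.nodeInteraction, Verifier.length_interact] using hj
  simp only [Verifier.nodeInteraction, Verifier.interact_eq, List.getElem_map, List.getElem_range,
    Encodings.transcript, List.getElem_ofFn]
  obtain ⟨t, rfl | rfl⟩ := j.even_or_odd'
  · rw [dif_pos (even_two_mul t)]
    simpa [Nat.mul_div_cancel_left] using
      (congrFun (roundMsg_even Q ℰ _ I ω ⟨t, by lia⟩) v).trans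
        (honest_next_interact Q ℰ I root W hW ω ⟨t, by lia⟩ v)
  · have half : (2 * t + 1) / 2 = t := by lia
    rw [dif_neg (by simp)]
    simpa only [half] using roundMsg_odd Q ℰ (honest ℰ root W) I ω ⟨t, by lia⟩ v

theorem proverMsg_honest (ω : (Q.verifier ℰ).Sample (honest ℰ root W)) :
    Q.proverMsg ℰ (honest ℰ root W) I ω = W ω.2 (ω.1 root) := by
  funext t v
  rw [proverMsg, nodeInteraction_honest Q ℰ I root W hW, Encodings.decode_transcript]

theorem acceptProb_honest (h : ∀ pc coins, Q.AllAccept I coins (W pc (coins root))) :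
    (Q.verifier ℰ).acceptProb (honest ℰ root W) I = 1 := by
  refine prob_of_forall fun ω v => ?_
  rw [run_eq_true_iff, proverMsg_honest Q ℰ I root W hW]
  exact h ω.2 ω.1 v

theorem view_honest (ω : (Q.verifier ℰ).Sample (honest ℰ root W)) (v : Fin n) :
    (Q.verifier ℰ).view (honest ℰ root W) I v ω =
      ℰ.nodeView (ω.1 v) (fun t => W ω.2 (ω.1 root) t v)
        (deliver I.graph (fun u => Q.send (I.localInput u) (ω.1 u)
          fun t => W ω.2 (ω.1 root) t u) v) := by
  have inbox_eq : ((Q.verifier ℰ).view (honest ℰ root W) I v ω).inbox =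
      [fun u => (deliver I.graph (fun u => Q.send (I.localInput u) (ω.1 u)
        (Q.proverMsg ℰ (honest ℰ root W) I ω · u)) v u).map ℰ.edge] := by
    simp only [deliver, apply_ite, Option.map_some, Option.map_none]
    rfl
  rw [proverMsg_honest Q ℰ I root W hW] at inbox_eq
  exact congrArg₂ (View.mk _) (nodeInteraction_honest Q ℰ I root W hW ω v) inbox_eq

end Honest

end PublicCoin

/-- A simulator of a public-coin protocol with typed messages. Every node sends `send` to its
neighbours, then samples on its own the coins of all nodes and those of the prover, and computes
from them and from what it received the messages from the prover and from its neighbours. -/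
structure LocalSimulator (n K : ℕ) (R M E PC : Type) where
  send : LocalInput n → Fin n → E
  message : LocalInput n → (Fin n → Option E) → (Fin n → Fin K → R) × PC → Fin (K + 1) → M
  receive : LocalInput n → (Fin n → Option E) → (Fin n → Fin K → R) × PC → Fin n → Option E

namespace LocalSimulator

variable {n K l B : ℕ} {R M E PC : Type} [Fintype R] [Nonempty R] [Nonempty E] [Fintype PC]
  [Nonempty PC] (S : LocalSimulator n K R M E PC) (ℰ : Encodings l B R M E) (I : Instance n)

/-- The simulator with binary messages. -/
noncomputable abbrev simulator : Simulator n 1 B (View n l B (Fin K → R)) where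
  Coin := (Fin n → Fin K → R) × PC
  alg :=
    { send := fun x _ u => ℰ.edge (S.send x.1 u)
      output := fun x m => ℰ.nodeView (x.2.1 x.1.id) (S.message x.1 (ℰ.decodeInbox m) x.2)
        (S.receive x.1 (ℰ.decodeInbox m) x.2) }

/-- What the node `v` receives in the simulation. -/
noncomputable abbrev received (v : Fin n) : Fin n → Option E :=
  deliver I.graph (fun u => S.send (I.localInput u)) v

theorem simulator_out (v : Fin n) (ω : Fin n → (Fin n → Fin K → R) × PC) :
    (S.simulator ℰ).out I v ω = ℰ.nodeView ((ω v).1 v)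
      (S.message (I.localInput v) (S.received I v) (ω v))
      (S.receive (I.localInput v) (S.received I v) (ω v)) := by
  rw [received, ← ℰ.decodeInbox_inbox_one (S.simulator ℰ).alg I.graph
    (fun u => (I.localInput u, ω u)) _ (fun _ _ => rfl) v]
  rfl

/-- The simulation is perfect if a permutation `Φ` of the sample space that preserves the nodes'
coins turns what the node really sees into what the simulator computes. -/
theorem tvDist_simulator_out_eq_zero [Nonempty M] (Q : PublicCoin n K R M E) (root : Fin n)
    (W : PC → (Fin K → R) → Fin (K + 1) → Fin n → M) (hW : ∀ pc, NonAnticipating (W pc))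
    (v : Fin n) (Φ : (Fin n → Fin K → R) × PC → (Fin n → Fin K → R) × PC) (hΦ : Bijective Φ)
    (hcoin : ∀ ω, (Φ ω).1 = ω.1)
    (hmessage : ∀ ω, S.message (I.localInput v) (S.received I v) (Φ ω) =
      fun t => W ω.2 (ω.1 root) t v)
    (hreceive : ∀ ω, S.receive (I.localInput v) (S.received I v) (Φ ω) =
      deliver I.graph (fun u => Q.send (I.localInput u) (ω.1 u) fun t => W ω.2 (ω.1 root) t u) v) :
    tvDist ((S.simulator ℰ).out I v)
      ((Q.verifier ℰ).view (PublicCoin.honest ℰ root W) I v) = 0 := by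
  let simView (ω : (Fin n → Fin K → R) × PC) : View n l B (Fin K → R) :=
    ℰ.nodeView (ω.1 v) (S.message (I.localInput v) (S.received I v) ω)
      (S.receive (I.localInput v) (S.received I v) ω)
  have view_eq (ω : (Fin n → Fin K → R) × PC) :
      (Q.verifier ℰ).view (PublicCoin.honest ℰ root W) I v ω = simView (Φ ω) := by
    simp only [simView, hcoin, hmessage, hreceive]
    exact Q.view_honest ℰ I root W hW ω v
  have prob_eq (A : Set (View n l B (Fin K → R))) :
      prob (fun ω => (S.simulator ℰ).out I v ω ∈ A) =
        prob fun ω => (Q.verifier ℰ).view (PublicCoin.honest ℰ root W) I v ω ∈ A :=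
    calc prob (fun ω => (S.simulator ℰ).out I v ω ∈ A)
      _ = prob fun ω : Fin n → (Fin n → Fin K → R) × PC => simView (ω v) ∈ A := by
        simp only [simulator_out, simView]
      _ = prob fun ω => simView ω ∈ A := prob_comp_eval (simView · ∈ A) v
      _ = prob fun ω => simView (Φ ω) ∈ A := (prob_comp_bijective (simView · ∈ A) hΦ).symm
      _ = prob fun ω => (Q.verifier ℰ).view (PublicCoin.honest ℰ root W) I v ω ∈ A := by
        simp only [← view_eq]
  simp [tvDist, prob_eq]

end LocalSimulator

/-! ### Polynomials with prescribed exponents -/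

open Polynomial

section SparsePolynomials

variable {F : Type} [Field F] {ι : Type*} [Fintype ι]

/-- The polynomial `∑ i, a i * X ^ e i`. It serves to commit to a polynomial by its coefficients,
to compare two vectors and to test several equations, each time at a single random point. -/
noncomputable def sparsePoly (e : ι → ℕ) (a : ι → F) : F[X] := ∑ i, C (a i) * X ^ e i

theorem eval_sparsePoly (e : ι → ℕ) (a : ι → F) (x : F) :
    (sparsePoly e a).eval x = ∑ i, a i * x ^ e i := by
  simp [sparsePoly, eval_finsetSum]

theorem natDegree_sparsePoly_le {e : ι → ℕ} {d : ℕ} (he : ∀ i, e i ≤ d) (a : ι → F) :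
    (sparsePoly e a).natDegree ≤ d :=
  natDegree_sum_le_of_forall_le _ _ fun i _ => (natDegree_C_mul_X_pow_le _ _).trans (he i)

theorem coeff_sparsePoly {e : ι → ℕ} (he : Injective e) (a : ι → F) (i : ι) :
    (sparsePoly e a).coeff (e i) = a i := by
  classical
  simp [sparsePoly, coeff_C_mul, coeff_X_pow, he.eq_iff]

theorem sparsePoly_injective {e : ι → ℕ} (he : Injective e) :
    Injective (sparsePoly e : (ι → F) → F[X]) := fun a b h => by
  funext i
  rw [← coeff_sparsePoly he a, h, coeff_sparsePoly he]

theorem sparsePoly_coeff {e : ι → ℕ} (he : Injective e) {P : F[X]}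
    (hP : ∀ m, m ∉ Set.range e → P.coeff m = 0) : sparsePoly e (fun i => P.coeff (e i)) = P := by
  ext m
  by_cases hm : m ∈ Set.range e
  · obtain ⟨i, rfl⟩ := hm
    exact coeff_sparsePoly he _ i
  · rw [hP m hm, sparsePoly, finsetSum_coeff]
    refine Finset.sum_eq_zero fun i _ => ?_
    rw [coeff_C_mul_X_pow, if_neg fun h => hm ⟨i, h.symm⟩]

theorem prob_eval_eq_eval_le {S : F → Prop} [Fintype {x // S x}] {P Q : F[X]} {d : ℕ}
    (hP : P.natDegree ≤ d) (hQ : Q.natDegree ≤ d) :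
    prob (fun x : {x // S x} => P ≠ Q ∧ P.eval x.1 = Q.eval x.1) ≤
      d / Fintype.card {x // S x} := by
  classical
  unfold prob
  gcongr
  by_cases hPQ : P = Q
  · simp [hPQ]
  have hd : (P - Q).roots.toFinset.card ≤ d :=
    (Multiset.toFinset_card_le _).trans
      ((card_roots' _).trans ((natDegree_sub_le P Q).trans (max_le hP hQ)))
  refine (Finset.card_le_card_of_injOn Subtype.val (fun x hx => ?_)
    Subtype.val_injective.injOn).trans hd
  simpa [hPQ, sub_eq_zero] using hx

theorem prob_eval_eq_eval_update_le {κ : Type} [Fintype κ] [DecidableEq κ] {S : F → Prop}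
    [Fintype {x // S x}] [Nonempty {x // S x}] {P Q : (κ → {x // S x}) → F[X]} {d : ℕ}
    (hP : ∀ c, (P c).natDegree ≤ d) (hQ : ∀ c, (Q c).natDegree ≤ d) (t : κ)
    (hPt : ∀ c x, P (update c t x) = P c) (hQt : ∀ c x, Q (update c t x) = Q c) :
    prob (fun c => P c ≠ Q c ∧ (P c).eval (c t).1 = (Q c).eval (c t).1) ≤
      d / Fintype.card {x // S x} := by
  refine prob_le_of_update (ι := κ) _ t fun c => ?_
  simp only [hPt, hQt, update_self]
  exact prob_eval_eq_eval_le (hP c) (hQ c)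

end SparsePolynomials

/-! ### The sum-check protocol -/

section SumCheck

variable {F ι : Type*} [Field F] [Fintype ι] {k : ℕ}

/-- A function that is polynomial of degree at most `d` in each variable separately: the
hypothesis under which the sum-check protocol is sound. -/
def PolynomialInEach (d : ℕ) (f : (Fin k → F) → F) : Prop :=
  ∀ x i, ∃ P : F[X], P.natDegree ≤ d ∧ ∀ y, P.eval y = f (update x i y)

/-- The sum of `f` over all values at the nodes of the variables from `i` on, the others being set
by `r`. The factor makes up for the summation over those others. -/
noncomputable def partialSum (α : ι → F) (f : (Fin k → F) → F) (i : ℕ) (r : Fin k → F) : F :=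
  ((Fintype.card ι : F) ^ i)⁻¹ * ∑ w : Fin k → ι, f fun j => if j.val < i then r j else α (w j)

/-- The polynomial that an honest prover commits to in the sum-check round of the variable `i`:
the partial sum as a function of that variable. -/
noncomputable def roundPoly (α : ι → F) (d : ℕ) (f : (Fin k → F) → F) (i : Fin k)
    (r : Fin k → F) : F[X] :=
  Classical.epsilon fun P : F[X] =>
    P.natDegree ≤ d ∧ ∀ y, P.eval y = partialSum α f (i + 1) (update r i y)

variable {α : ι → F} {d : ℕ} {f : (Fin k → F) → F}

theorem partialSum_congr {i : ℕ} {r r' : Fin k → F} (h : ∀ j : Fin k, j.val < i → r j = r' j) :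
    partialSum α f i r = partialSum α f i r' := by
  have (w : Fin k → ι) : (fun j : Fin k => if j.val < i then r j else α (w j)) =
      fun j => if j.val < i then r' j else α (w j) :=
    funext fun j => ite_congr rfl (h j) fun _ => rfl
  simp only [partialSum, this]

theorem partialSum_zero (r : Fin k → F) :
    partialSum α f 0 r = ∑ w : Fin k → ι, f fun j => α (w j) := by
  simp [partialSum]

theorem partialSum_last (hι : (Fintype.card ι : F) ≠ 0) (r : Fin k → F) :
    partialSum α f k r = f r := by
  simp [partialSum, hι]

theorem update_ite_lt_succ {β : Type*} (r s : Fin k → β) (i : Fin k) (y : β) :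
    (fun j : Fin k => if j.val < i.val + 1 then update r i y j else s j) =
      update (fun j => if j.val < i.val then r j else s j) i y := by
  funext j
  rcases eq_or_ne j i with rfl | hj
  · simp
  · have : j.val < i.val + 1 ↔ j.val < i.val := by
      have := Fin.val_ne_of_ne hj
      omega
    simp [hj, this]

theorem sum_partialSum_succ (hι : (Fintype.card ι : F) ≠ 0) (i : Fin k) (r : Fin k → F) :
    ∑ v, partialSum α f (i + 1) (update r i (α v)) = partialSum α f i r := by
  have update_comp (w : Fin k → ι) (v : ι) :
      update (fun j => if j.val < i.val then r j else α (w j)) i (α v) =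
        fun j => if j.val < i.val then r j else α (update w i v j) := by
    funext j
    rcases eq_or_ne j i with rfl | hj
    · simp
    · simp [hj]
  unfold partialSum
  classical
  rw [← Finset.mul_sum, Finset.sum_comm]
  simp only [update_ite_lt_succ, update_comp,
    sum_sum_update (fun w : Fin k → ι => f fun j => if j.val < i.val then r j else α (w j)) i]
  rw [nsmul_eq_mul, pow_succ]
  field_simp

theorem PolynomialInEach.exists_eval_eq_partialSum (hf : PolynomialInEach d f) (i : Fin k)
    (r : Fin k → F) :
    ∃ P : F[X], P.natDegree ≤ d ∧ ∀ y, P.eval y = partialSum α f (i + 1) (update r i y) := by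
  choose P hdegree heval using fun x => hf x i
  refine ⟨C (((Fintype.card ι : F) ^ (i.val + 1))⁻¹) *
    ∑ w : Fin k → ι, P fun j => if j.val < i.val then r j else α (w j),
    (natDegree_C_mul_le _ _).trans (natDegree_sum_le_of_forall_le _ _ fun w _ => hdegree _),
    fun y => ?_⟩
  simp only [eval_mul, eval_C, eval_finsetSum, heval, partialSum, update_ite_lt_succ]

section RoundPoly

variable (hf : PolynomialInEach d f) (i : Fin k) (r : Fin k → F)
include hf

theorem natDegree_roundPoly_le : (roundPoly α d f i r).natDegree ≤ d :=
  (Classical.epsilon_spec (hf.exists_eval_eq_partialSum i r)).1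

theorem eval_roundPoly (y : F) :
    (roundPoly α d f i r).eval y = partialSum α f (i + 1) (update r i y) :=
  (Classical.epsilon_spec (hf.exists_eval_eq_partialSum i r)).2 y

theorem eval_roundPoly_self :
    (roundPoly α d f i r).eval (r i) = partialSum α f (i + 1) r := by
  rw [eval_roundPoly hf, update_eq_self]

theorem sum_eval_roundPoly (hι : (Fintype.card ι : F) ≠ 0) :
    ∑ v, (roundPoly α d f i r).eval (α v) = partialSum α f i r := by
  simp only [eval_roundPoly hf, sum_partialSum_succ hι]

end RoundPoly

theorem roundPoly_congr {i : Fin k} {r r' : Fin k → F} (h : ∀ j < i, r j = r' j) :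
    roundPoly α d f i r = roundPoly α d f i r' := by
  have (y : F) : partialSum α f (i + 1) (update r i y) =
      partialSum α f (i + 1) (update r' i y) := by
    refine partialSum_congr fun j hj => ?_
    rcases eq_or_ne j i with rfl | hji
    · simp
    · simp [hji, h j (lt_of_le_of_ne (Nat.lt_succ_iff.1 hj) hji)]
  simp only [roundPoly, this]

theorem exists_bad_round (hι : (Fintype.card ι : F) ≠ 0) (hf : PolynomialInEach d f)
    (r : Fin k → F) (P : Fin k → F[X]) (claim : Fin (k + 1) → F)
    (heval : ∀ i, claim i.succ = (P i).eval (r i))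
    (hsum : ∀ i, ∑ v, (P i).eval (α v) = claim i.castSucc)
    (hlast : f r = claim (Fin.last k)) (hne : claim 0 ≠ partialSum α f 0 r) :
    ∃ i, P i ≠ roundPoly α d f i r ∧ (P i).eval (r i) = (roundPoly α d f i r).eval (r i) := by
  by_contra! hgood
  have claim_eq (m : Fin (k + 1)) : claim m = partialSum α f m r := by
    induction m using Fin.reverseInduction with
    | last => rw [← hlast, Fin.val_last, partialSum_last hι]
    | cast i ih =>
      rw [Fin.val_succ, heval, ← eval_roundPoly_self hf] at ih
      have hP : P i = roundPoly α d f i r := not_imp_not.1 (hgood i) ih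
      rw [← hsum, hP, sum_eval_roundPoly hf i r hι, Fin.val_castSucc]
  exact hne (claim_eq 0)

end SumCheck

/-! ### Masked extensions of matrices -/

section MaskedExtension

variable {F ι : Type*} [Field F] [Fintype ι] [DecidableEq ι] {k : ℕ} (α : ι → F)

/-- The low-degree extension of the matrix `M` to the points `x`, `y` of the field, the index `u`
being placed at `α u`, masked by a multiple of a polynomial that vanishes at the nodes. -/
noncomputable def maskedExtension (M : ι → ι → F) (ρ x y : F) : F :=
  ∑ v, ∑ u, (Lagrange.basis Finset.univ α v).eval y *
      ((Lagrange.basis Finset.univ α u).eval x * M u v) +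
    ρ * ((Lagrange.nodal Finset.univ α).eval x * (Lagrange.nodal Finset.univ α).eval y)

variable {α}

theorem eval_basis_node (hα : Injective α) (u v : ι) :
    (Lagrange.basis Finset.univ α u).eval (α v) = if u = v then 1 else 0 := by
  split_ifs with h
  · rw [h, Lagrange.eval_basis_self hα.injOn (Finset.mem_univ _)]
  · exact Lagrange.eval_basis_of_ne h (Finset.mem_univ _)

theorem maskedExtension_node (hα : Injective α) (M : ι → ι → F) (ρ : F) (u v : ι) :
    maskedExtension α M ρ (α u) (α v) = M u v := by
  simp [maskedExtension, eval_basis_node hα, Lagrange.eval_nodal_at_node]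

theorem maskedExtension_flip (M : ι → ι → F) (ρ x y : F) :
    maskedExtension α (flip M) ρ y x = maskedExtension α M ρ x y := by
  unfold maskedExtension flip
  rw [Finset.sum_comm]
  congr 1
  · exact Finset.sum_congr rfl fun _ _ => Finset.sum_congr rfl fun _ _ => by ring
  · ring

theorem exists_eval_eq_maskedExtension (hα : Injective α) (M : ι → ι → F) (ρ y : F) :
    ∃ P : F[X], P.natDegree ≤ Fintype.card ι ∧ ∀ x, P.eval x = maskedExtension α M ρ x y := by
  refine ⟨∑ v, ∑ u, C ((Lagrange.basis Finset.univ α v).eval y * M u v) *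
      Lagrange.basis Finset.univ α u +
    C (ρ * (Lagrange.nodal Finset.univ α).eval y) * Lagrange.nodal Finset.univ α, ?_, fun x => ?_⟩
  · refine natDegree_add_le_of_degree_le (natDegree_sum_le_of_forall_le _ _ fun v _ =>
      natDegree_sum_le_of_forall_le _ _ fun u _ => (natDegree_C_mul_le _ _).trans ?_)
      ((natDegree_C_mul_le _ _).trans ?_)
    · simp [Lagrange.natDegree_basis hα.injOn (Finset.mem_univ u)]
    · simp [Lagrange.natDegree_nodal]
  · simp only [eval_add, eval_finsetSum, eval_mul, eval_C, maskedExtension]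
    congr 1
    · exact Finset.sum_congr rfl fun _ _ => Finset.sum_congr rfl fun _ _ => by ring
    · ring

theorem exists_eval_eq_maskedExtension_update (hα : Injective α) (M : ι → ι → F) (ρ : F)
    (x : Fin k → F) (i : Fin k) {a b : Fin k} (hab : a ≠ b) :
    ∃ P : F[X], P.natDegree ≤ (if a = i ∨ b = i then Fintype.card ι else 0) ∧
      ∀ y, P.eval y = maskedExtension α M ρ (update x i y a) (update x i y b) := by
  rcases eq_or_ne a i with rfl | ha
  · obtain ⟨P, hdegree, heval⟩ := exists_eval_eq_maskedExtension hα M ρ (x b)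
    exact ⟨P, by simpa using hdegree, fun y => by simp [heval, hab.symm]⟩
  rcases eq_or_ne b i with rfl | hb
  · obtain ⟨P, hdegree, heval⟩ := exists_eval_eq_maskedExtension hα (flip M) ρ (x a)
    exact ⟨P, by simpa using hdegree, fun y => by simp [heval, maskedExtension_flip, hab]⟩
  · exact ⟨C (maskedExtension α M ρ (x a) (x b)), by simp, fun y => by simp [ha, hb]⟩

/-- The pairs of pattern vertices, each taken once. -/
def pairs (k : ℕ) : Finset (Fin k × Fin k) := Finset.univ.filter fun p => p.1 < p.2

theorem mem_pairs {p : Fin k × Fin k} : p ∈ pairs k ↔ p.1 < p.2 := by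
  simp [pairs]

theorem card_pairs_through_le (i : Fin k) :
    ((pairs k).filter fun p => p.1 = i ∨ p.2 = i).card ≤ k - 1 := by
  have hsubset : ((pairs k).filter fun p => p.1 = i ∨ p.2 = i) ⊆
      (Finset.univ.erase i).image fun j => (min i j, max i j) := by
    rintro ⟨a, b⟩ hp
    obtain ⟨hlt, rfl | rfl⟩ : a < b ∧ (a = i ∨ b = i) := by simpa [mem_pairs] using hp
    · exact Finset.mem_image.2 ⟨b, by simp [hlt.ne'], by simp [hlt.le]⟩
    · exact Finset.mem_image.2 ⟨a, by simp [hlt.ne], by simp [hlt.le]⟩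
  calc _ ≤ _ := Finset.card_le_card hsubset
    _ ≤ (Finset.univ.erase i).card := Finset.card_image_le
    _ = k - 1 := by simp

variable (α) in
/-- The product over all pairs `a < b` of pattern vertices of the masked extension of the matrix
`M a b`: the function whose sum over the nodes is checked. -/
noncomputable def maskedPattern (M : Fin k → Fin k → ι → ι → F) (ρ : Fin k → Fin k → F)
    (x : Fin k → F) : F :=
  ∏ p ∈ pairs k, maskedExtension α (M p.1 p.2) (ρ p.1 p.2) (x p.1) (x p.2)

theorem polynomialInEach_maskedPattern (hα : Injective α) (M : Fin k → Fin k → ι → ι → F)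
    (ρ : Fin k → Fin k → F) :
    PolynomialInEach ((k - 1) * Fintype.card ι) (maskedPattern α M ρ) := by
  intro x i
  have hfactor := fun (p : Fin k × Fin k) (hp : p ∈ pairs k) =>
    exists_eval_eq_maskedExtension_update hα (M p.1 p.2) (ρ p.1 p.2) x i (mem_pairs.1 hp).ne
  choose! P hdegree heval using hfactor
  refine ⟨∏ p ∈ pairs k, P p, ?_, fun y => ?_⟩
  · calc (∏ p ∈ pairs k, P p).natDegree
        ≤ ∑ p ∈ pairs k, if p.1 = i ∨ p.2 = i then Fintype.card ι else 0 :=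
          (natDegree_prod_le _ _).trans (Finset.sum_le_sum hdegree)
      _ = ((pairs k).filter fun p => p.1 = i ∨ p.2 = i).card * Fintype.card ι := by
          rw [← Finset.sum_filter, Finset.sum_const, smul_eq_mul]
      _ ≤ (k - 1) * Fintype.card ι := Nat.mul_le_mul_right _ (card_pairs_through_le i)
  · rw [eval_prod, maskedPattern]
    exact Finset.prod_congr rfl fun p hp => heval p hp y

end MaskedExtension

/-! ### The matrices of a graph -/

section Entries

variable {n k : ℕ} (F : Type) [Field F] (κ : CopyKind) (H : SimpleGraph (Fin k))

open Classical in
/-- The entry `u` of the row, known to a node with local input `li`, of the 0/1 matrix for the pair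
`a`, `b` of pattern vertices. -/
noncomputable def localEntry (li : LocalInput n) (a b : Fin k) (u : Fin n) : F :=
  if u ≠ li.id ∧ PairOk κ H a b (u ∈ li.nbrs) then 1 else 0

/-- The 0/1 matrix that tells for which nodes `u`, `v` the pair `a`, `b` of pattern vertices may be
mapped to `u`, `v`. -/
noncomputable def entry (I : Instance n) (a b : Fin k) (u v : Fin n) : F :=
  localEntry F κ H (I.localInput v) a b u

open Classical in
theorem prod_entry (I : Instance n) (w : Fin k → Fin n) :
    ∏ p ∈ pairs k, entry F κ H I p.1 p.2 (w p.1) (w p.2) =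
      if IsLabelledCopy κ H I.graph w then 1 else 0 := by
  simp only [entry, localEntry, Instance.localInput, SimpleGraph.mem_neighborSet,
    I.graph.adj_comm (w (_ : Fin k × Fin k).2), isLabelledCopy_iff_forall_lt]
  split_ifs with h
  · exact Finset.prod_eq_one fun p hp => if_pos (h p.1 p.2 (mem_pairs.1 hp))
  · push Not at h
    obtain ⟨a, b, hab, h⟩ := h
    exact Finset.prod_eq_zero (i := (a, b)) (mem_pairs.2 hab) (if_neg fun hok => h hok.1 hok.2)

theorem sum_prod_entry (I : Instance n) :
    ∑ w : Fin k → Fin n, ∏ p ∈ pairs k, entry F κ H I p.1 p.2 (w p.1) (w p.2) =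
      ((Nat.card (H ≃g H) * numCopies κ H I.graph : ℕ) : F) := by
  classical
  rw [← card_isLabelledCopy, Nat.card_eq_fintype_card, Fintype.card_subtype]
  simp only [prod_entry, Finset.sum_boole]

end Entries

/-! ### Sums over the spanning tree -/

namespace Instance

variable {n : ℕ} (I : Instance n)

include I in
theorem pos : 0 < n := by
  obtain ⟨v⟩ := I.connected.nonempty
  exact v.pos

/-- The node with identifier `0`. -/
def root : Fin n := ⟨0, I.pos⟩

theorem val_eq_zero_iff (v : Fin n) : v.val = 0 ↔ v = I.root :=
  (Fin.ext_iff (b := I.root)).symm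

theorem adj_and_parent_eq_iff {u v : Fin n} :
    I.graph.Adj u v ∧ I.parent u = v ↔ u ≠ I.root ∧ I.parent u = v := by
  refine and_congr_left fun h => ⟨?_, fun hu => ?_⟩
  · rintro hadj rfl
    exact hadj.ne (by rw [← h, I.parent_root _ rfl])
  · rw [← h]
    exact I.parent_adj u fun h0 => hu ((I.val_eq_zero_iff u).1 h0)

theorem parent_induction {C : Fin n → Prop} (hroot : C I.root)
    (hparent : ∀ v, v ≠ I.root → C (I.parent v) → C v) (v : Fin n) : C v := by
  obtain ⟨m, hm⟩ := I.parent_reaches_root v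
  induction m generalizing v with
  | zero => exact (I.val_eq_zero_iff v).1 hm ▸ hroot
  | succ m ih =>
    by_cases hv : v = I.root
    · exact hv ▸ hroot
    · exact hparent v hv (ih _ hm)

end Instance

section Tree

variable {F : Type} [Field F] {n : ℕ} (I : Instance n)

/-- The linear map that takes `s` to the function whose value at `v` is the sum of `s` over the
children of `v`. -/
def childSum : (Fin n → F) →ₗ[F] Fin n → F :=
  LinearMap.pi fun v => ∑ u, if u ≠ I.root ∧ I.parent u = v then LinearMap.proj u else 0

theorem childSum_apply (s : Fin n → F) (v : Fin n) :
    childSum I s v = ∑ u, if u ≠ I.root ∧ I.parent u = v then s u else 0 := by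
  simp only [childSum, LinearMap.pi_apply, LinearMap.sum_apply]
  exact Finset.sum_congr rfl fun u _ => by split_ifs <;> rfl

theorem childSum_single (u : Fin n) (x : F) :
    childSum I (Pi.single u x) = if u = I.root then 0 else Pi.single (I.parent u) x := by
  funext v
  rw [childSum_apply, Finset.sum_eq_single u (fun u' _ hu' => by simp [hu']) (by simp)]
  by_cases hu : u = I.root
  · simp [hu]
  · simp [hu, Pi.single_apply, eq_comm]

theorem sum_childSum (s : Fin n → F) : ∑ v, childSum I s v = ∑ u, s u - s I.root := by
  simp only [childSum_apply]
  rw [Finset.sum_comm, ← Finset.sum_erase_eq_sub (Finset.mem_univ I.root)]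
  simp only [ite_and, Finset.sum_ite_irrel, Finset.sum_ite_eq, Finset.mem_univ, if_true,
    Finset.sum_const_zero, ← Finset.filter_ne', Finset.sum_filter]

theorem exists_eq_add_childSum (c : Fin n → F) : ∃ s, s = c + childSum I s := by
  have single_mem_range (u : Fin n) :
      ∀ x : F, Pi.single u x ∈ LinearMap.range (LinearMap.id - childSum (F := F) I) := by
    induction u using I.parent_induction with
    | hroot => exact fun x => ⟨Pi.single I.root x, by simp [childSum_single]⟩
    | hparent u hu ih =>
      intro x
      have := add_mem (LinearMap.mem_range_self _ (Pi.single u x)) (ih x)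
      simpa [childSum_single, hu] using this
  have hc : c ∈ LinearMap.range (LinearMap.id - childSum (F := F) I) := by
    rw [← Finset.univ_sum_single c]
    exact sum_mem fun u _ => single_mem_range u (c u)
  obtain ⟨s, hs⟩ := hc
  exact ⟨s, by simp [← hs]⟩

/-- The sums of `c` over the subtrees of the nodes. -/
noncomputable def treeSum (c : Fin n → F) : Fin n → F :=
  (exists_eq_add_childSum I c).choose

theorem treeSum_eq (c : Fin n → F) : treeSum I c = c + childSum I (treeSum I c) :=
  (exists_eq_add_childSum I c).choose_spec

theorem treeSum_root (c : Fin n → F) : treeSum I c I.root = ∑ v, c v := by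
  have h : ∑ v, treeSum I c v = ∑ v, c v + ∑ v, childSum I (treeSum I c) v := by
    rw [← Finset.sum_add_distrib]
    exact Finset.sum_congr rfl fun v _ => congrFun (treeSum_eq I c) v
  rw [sum_childSum] at h
  linear_combination h

theorem elim_deliver {E : Type} (msg : Fin n → Fin n → E) {f : E → F} {x : F} {u v : Fin n}
    (hf : f (msg u v) = if I.parent u = v then x else 0) :
    (deliver I.graph msg v u).elim 0 f = if u ≠ I.root ∧ I.parent u = v then x else 0 := by
  classical
  rw [← if_congr I.adj_and_parent_eq_iff rfl rfl, ite_and, ← hf, deliver]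
  split_ifs <;> rfl

end Tree

/-! ### The protocol -/

/-- The data of a node in the protocol: its shares of the coefficients of the round polynomials, by
round and slot (`ownShare` for its own coefficients, `nextShare` for those of the next node), its
shares of the masks and the claimed values of the masked extensions (both at `b`, `a` for the pair
`a < b`), and the challenges of the sum-check rounds. -/
structure Tables (k : ℕ) (F : Type) where
  ownShare : Fin k → Fin k → F
  nextShare : Fin k → Fin k → F
  maskShare : Fin k → Fin k → F
  claim : Fin k → Fin k → F
  challenge : Fin k → F

/-- A prover message to a node: rows of the four tables, the last challenge, the mask of the node
for the final summation, the sum of these masks, and the masked sum over the subtree of the node.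
Every message has all these fields; the verifier ignores those that are of no use at the time. -/
structure Msg (k : ℕ) (F : Type) where
  ownShare : Fin k → F
  nextShare : Fin k → F
  maskShare : Fin k → F
  claim : Fin k → F
  echo : F
  mask : F
  maskTotal : F
  subtreeSum : F

/-- A message to a neighbour: the last challenge, a fingerprint of the others, and, to the parent,
the masked sum over the subtree. -/
structure EdgeMsg (F : Type) where
  challenge : F
  fingerprint : F
  subtreeSum : F

instance {k : ℕ} {F : Type} [Nonempty F] : Nonempty (Msg k F) :=
  ‹Nonempty F›.map fun x => ⟨fun _ => x, fun _ => x, fun _ => x, fun _ => x, x, x, x, x⟩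

instance {F : Type} [Nonempty F] : Nonempty (EdgeMsg F) :=
  ‹Nonempty F›.map fun x => ⟨x, x, x⟩

/-- A challenge of the verifier. It is not one of the nodes, where the masks vanish. -/
abbrev Challenge {F ι : Type} (α : ι → F) : Type := {x : F // ∀ v, x ≠ α v}

/-- The index of the challenge of the sum-check round `i`. -/
def sumTime {k : ℕ} (i : Fin k) : Fin (2 * k + 1) := ⟨k + i, by lia⟩

/-- The index of the challenge after the message with the row `b` of the masks. There are such
rounds only because all masks at once would not fit into a message. -/
def maskTime {k : ℕ} (b : Fin k) : Fin (2 * k + 1) := ⟨b, by lia⟩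

theorem sumTime_injective {k : ℕ} : Injective (sumTime (k := k)) := fun _ _ h =>
  Fin.ext (Nat.add_left_cancel (Fin.val_eq_of_eq h))

theorem maskTime_injective {k : ℕ} : Injective (maskTime (k := k)) := fun _ _ h =>
  Fin.ext (Fin.mk.inj h)

/-- The indices of the linear checks: the equations between consecutive rounds of the sum-check
protocol, and the claimed values of the masked extensions. -/
abbrev CheckIndex (k : ℕ) : Type := Fin (k + 1) ⊕ pairs k

/-- The exponent of a linear check in the random linear combination of all checks. It is positive,
as the constant coefficient is taken by the masks. -/
noncomputable def checkExp {k : ℕ} (j : CheckIndex k) : ℕ := (Fintype.equivFin _ j).val + 1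

theorem checkExp_injective {k : ℕ} : Injective (checkExp (k := k)) := fun _ _ h =>
  (Fintype.equivFin _).injective (Fin.ext (Nat.succ_injective h))

theorem checkExp_le {k : ℕ} (j : CheckIndex k) : checkExp j ≤ (k + 1) ^ 2 := by
  have hlt := (Fintype.equivFin (CheckIndex k) j).isLt
  have hpairs : (pairs k).card ≤ k * k := (Finset.card_le_univ _).trans_eq (by simp)
  simp only [Fintype.card_sum, Fintype.card_fin, Fintype.card_coe] at hlt
  unfold checkExp
  linarith

/-- The exponent of the coefficient that a node holds in a slot. -/
def coefExp {n k : ℕ} (p : Fin n × Fin k) : ℕ := finProdFinEquiv p.swap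

theorem coefExp_injective {n k : ℕ} : Injective (coefExp (n := n) (k := k)) := fun _ _ h =>
  Prod.swap_injective (finProdFinEquiv.injective (Fin.ext h))

theorem coefExp_le {n k : ℕ} (p : Fin n × Fin k) : coefExp p ≤ k * n :=
  (finProdFinEquiv p.swap).isLt.le

theorem mem_range_coefExp {n k m : ℕ} (hm : m < k * n) :
    m ∈ Set.range (coefExp (n := n) (k := k)) :=
  ⟨(finProdFinEquiv.symm ⟨m, hm⟩).swap, by simp [coefExp, Nat.mod_add_div]⟩

section Protocol

variable {F : Type} [Field F] {n k : ℕ}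

/-- The tables contained in the prover messages to a node. -/
def readTables (w : Fin (2 * k + 1 + 1) → Msg k F) : Tables k F where
  ownShare i := (w (sumTime i).castSucc).ownShare
  nextShare i := (w (sumTime i).castSucc).nextShare
  maskShare b := (w (maskTime b).castSucc).maskShare
  claim b := (w (sumTime b).succ).claim
  challenge i := (w (sumTime i).succ).echo

/-- The contribution of a node to the value at `x` of the shared polynomial of the round `i`. -/
def localEval (v : Fin n) (T : Tables k F) (i : Fin k) (x : F) : F :=
  ∑ j, (T.ownShare i j * x ^ coefExp (v, j) + T.nextShare i j * x ^ coefExp (finRotate n v, j))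

/-- The polynomial whose coefficients the nodes share in the round `i`. -/
noncomputable def sharedPoly (T : Fin n → Tables k F) (i : Fin k) : F[X] :=
  sparsePoly coefExp fun p : Fin n × Fin k =>
    (T p.1).ownShare i p.2 + (T ((finRotate n).symm p.1)).nextShare i p.2

theorem sum_localEval (T : Fin n → Tables k F) (i : Fin k) (x : F) :
    ∑ v, localEval v (T v) i x = (sharedPoly T i).eval x := by
  simp only [sharedPoly, eval_sparsePoly, localEval, Fintype.sum_prod_type, add_mul,
    Finset.sum_add_distrib]
  congr 1
  exact Fintype.sum_equiv (finRotate n) _ _ fun v => by simp only [Equiv.symm_apply_apply]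

variable (α : Fin n → F) (κ : CopyKind) (H : SimpleGraph (Fin k))

/-- The contribution of a node to the left-hand side of a sum-check equation. -/
noncomputable def localLhs (li : LocalInput n) (T : Tables k F) : Fin (k + 1) → F :=
  Fin.lastCases (if li.id.val = 0 then ∏ p ∈ pairs k, T.claim p.2 p.1 else 0)
    fun i => ∑ u, localEval li.id T i (α u)

/-- The contribution of a node to the right-hand side of a sum-check equation. -/
noncomputable def localRhs (li : LocalInput n) (T : Tables k F) : Fin (k + 1) → F :=
  Fin.cases (if li.id.val = 0 then ((Nat.card (H ≃g H) * li.target : ℕ) : F) else 0)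
    fun i => localEval li.id T i (T.challenge i)

/-- The contribution of a node to the check of the claimed value of a masked extension. -/
noncomputable def localPairCheck (li : LocalInput n) (T : Tables k F) (a b : Fin k) : F :=
  (if li.id.val = 0 then T.claim b a else 0) -
    (∑ u, (Lagrange.basis Finset.univ α li.id).eval (T.challenge b) *
        ((Lagrange.basis Finset.univ α u).eval (T.challenge a) * localEntry F κ H li a b u) +
      T.maskShare b a * ((Lagrange.nodal Finset.univ α).eval (T.challenge a) *
        (Lagrange.nodal Finset.univ α).eval (T.challenge b)))

/-- The contribution of a node to a linear check. -/
noncomputable def localCheck (li : LocalInput n) (T : Tables k F) : CheckIndex k → F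
  | .inl i => localLhs α li T i - localRhs H li T i
  | .inr p => localPairCheck α κ H li T p.1.1 p.1.2

/-- The contribution of a node to the random linear combination of all linear checks. -/
noncomputable def localComb (li : LocalInput n) (T : Tables k F) (σ : F) : F :=
  (sparsePoly checkExp (localCheck α κ H li T)).eval σ

/-- The fingerprint that a node computes from the challenges that the prover reports to it. -/
noncomputable def nodeFingerprint (w : Fin (2 * k + 1 + 1) → Msg k F) : F :=
  (sparsePoly Fin.val (readTables w).challenge).eval (w (Fin.last _)).echo

variable {α}

/-- The challenges of the sum-check rounds. -/
def sumChallenges (c : Fin (2 * k + 1) → Challenge α) (i : Fin k) : F := (c (sumTime i)).1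

/-- The last challenge, for the random linear combination and the fingerprint. -/
def lastChallenge (c : Fin (2 * k + 1) → Challenge α) : F := (c (Fin.last _)).1

/-- The conditions under which a node accepts. Only the root compares the challenges reported by the
prover with its coins; the others compare them with those reported to their neighbours. -/
structure Accepts (κ : CopyKind) (H : SimpleGraph (Fin k)) (li : LocalInput n)
    (c : Fin (2 * k + 1) → Challenge α) (w : Fin (2 * k + 1 + 1) → Msg k F)
    (inb : Fin n → Option (EdgeMsg F)) : Prop where
  target_le : Nat.card (H ≃g H) * li.target ≤ n ^ k
  root_challenge : li.id.val = 0 → (readTables w).challenge = sumChallenges c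
  root_last : li.id.val = 0 → (w (Fin.last _)).echo = lastChallenge c
  root_sum : li.id.val = 0 → (w (Fin.last _)).subtreeSum = (w 0).maskTotal
  neighbor : ∀ u m, inb u = some m →
    m.challenge = (w (Fin.last _)).echo ∧ m.fingerprint = nodeFingerprint w
  subtreeSum_eq : (w (Fin.last _)).subtreeSum =
    localComb α κ H li (readTables w) (w (Fin.last _)).echo + (w 0).mask +
      ∑ u, (inb u).elim 0 EdgeMsg.subtreeSum

variable (α) in
/-- The protocol for counting the copies of `H`. -/
noncomputable def protocol :
    PublicCoin n (2 * k + 1) (Challenge α) (Msg k F) (EdgeMsg F) where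
  send li _ w u :=
    { challenge := (w (Fin.last _)).echo
      fingerprint := nodeFingerprint w
      subtreeSum := if li.parent = u then (w (Fin.last _)).subtreeSum else 0 }
  accept := Accepts κ H

/-- The tables contained in the prover messages to all nodes. -/
def tablesOf (w : Fin (2 * k + 1 + 1) → Fin n → Msg k F) (v : Fin n) : Tables k F :=
  readTables fun t => w t v

variable {κ H} (I : Instance n)

theorem sum_deliver_protocol (coins : Fin n → Fin (2 * k + 1) → Challenge α)
    (w : Fin (2 * k + 1 + 1) → Fin n → Msg k F) (v : Fin n) :
    ∑ u, (deliver I.graph (fun u => (protocol α κ H).send (I.localInput u) (coins u)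
        fun t => w t u) v u).elim 0 EdgeMsg.subtreeSum =
      childSum I (fun u => (w (Fin.last _) u).subtreeSum) v := by
  rw [childSum_apply]
  exact Finset.sum_congr rfl fun u _ => elim_deliver I _ rfl

section AllAccept

variable {I} {coins : Fin n → Fin (2 * k + 1) → Challenge α}
  {w : Fin (2 * k + 1 + 1) → Fin n → Msg k F} (h : (protocol α κ H).AllAccept I coins w)
include h

theorem echo_eq_and_fingerprint_eq_of_allAccept (v : Fin n) :
    (w (Fin.last _) v).echo = lastChallenge (coins I.root) ∧
      (sparsePoly Fin.val (tablesOf w v).challenge).eval (lastChallenge (coins I.root)) =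
        (sparsePoly Fin.val (sumChallenges (coins I.root))).eval
          (lastChallenge (coins I.root)) := by
  have walk_eq {u v : Fin n} (p : I.graph.Walk u v) :
      (w (Fin.last _) u).echo = (w (Fin.last _) v).echo ∧
        nodeFingerprint (fun t => w t u) = nodeFingerprint fun t => w t v := by
    induction p with
    | nil => exact ⟨rfl, rfl⟩
    | @cons u v _ huv _ ih =>
      obtain ⟨hecho, hfingerprint⟩ := (h u).neighbor v _ (if_pos huv.symm)
      exact ⟨hecho.symm.trans ih.1, hfingerprint.symm.trans ih.2⟩
  obtain ⟨p⟩ := I.connected.preconnected v I.root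
  obtain ⟨hecho, hfingerprint⟩ := walk_eq p
  rw [(h I.root).root_last rfl] at hecho
  simp only [nodeFingerprint, hecho, (h I.root).root_last rfl,
    (h I.root).root_challenge rfl] at hfingerprint
  exact ⟨hecho, hfingerprint⟩

theorem sum_localComb_of_allAccept :
    ∑ v, (localComb α κ H (I.localInput v) (tablesOf w v) (lastChallenge (coins I.root)) +
      (w 0 v).mask) = (w 0 I.root).maskTotal := by
  have hnode := fun v => (h v).subtreeSum_eq
  simp only [sum_deliver_protocol, (echo_eq_and_fingerprint_eq_of_allAccept h _).1] at hnode
  have hsum := Finset.sum_congr rfl fun v (_ : v ∈ Finset.univ) => hnode v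
  rw [Finset.sum_add_distrib, sum_childSum, (h I.root).root_sum rfl] at hsum
  simp only [tablesOf]
  linear_combination -hsum

end AllAccept

end Protocol

/-! ### Soundness -/

section Update

variable {F : Type} {n k : ℕ} {α : Fin n → F}

theorem sumChallenges_update {c : Fin (2 * k + 1) → Challenge α} {t : Fin (2 * k + 1)}
    {x : Challenge α} {i : Fin k} (h : sumTime i ≠ t) :
    sumChallenges (update c t x) i = sumChallenges c i := by
  rw [sumChallenges, update_of_ne h, sumChallenges]

theorem NonAnticipating.update {K : ℕ} {R β : Type} {W : (Fin K → R) → Fin (K + 1) → β}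
    (hW : NonAnticipating W) {t : Fin K} {s : Fin (K + 1)} (hs : s ≤ t.castSucc)
    (c : Fin K → R) (x : R) : W (update c t x) s = W c s :=
  hW _ _ _ fun _ hj => update_of_ne (Fin.castSucc_lt_castSucc_iff.1 (hj.trans_le hs)).ne _ _

theorem sumChallenges_update_last (c : Fin (2 * k + 1) → Challenge α) (x : Challenge α) :
    sumChallenges (update c (Fin.last _) x) = sumChallenges c :=
  funext fun i => sumChallenges_update (by simp [sumTime, Fin.ext_iff]; lia)

theorem tablesOf_update_last
    {W : (Fin (2 * k + 1) → Challenge α) → Fin (2 * k + 1 + 1) → Fin n → Msg k F}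
    (hW : NonAnticipating W) (c : Fin (2 * k + 1) → Challenge α) (x : Challenge α) :
    tablesOf (W (update c (Fin.last _) x)) = tablesOf (W c) := by
  have hle (t : Fin (2 * k + 1)) := hW.update (Fin.castSucc_le_castSucc_iff.2 t.le_last) c x
  have hsucc (i : Fin k) : (sumTime i).succ ≤ (Fin.last (2 * k)).castSucc := by
    simp [sumTime, Fin.le_def]; lia
  funext v
  simp only [tablesOf, readTables, hle, hW.update (hsucc _) c x]

end Update

variable {F : Type} [Field F] {n k : ℕ}

section Checks

variable (α : Fin n → F) (κ : CopyKind) (H : SimpleGraph (Fin k)) (I : Instance n)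
  (T : Fin n → Tables k F)

theorem sum_ite_root (x : Fin n → F) :
    ∑ v, (if (I.localInput v).id.val = 0 then x v else 0) = x I.root := by
  simp [Instance.localInput, I.val_eq_zero_iff]

theorem sum_localLhs_castSucc (i : Fin k) :
    ∑ v, localLhs α (I.localInput v) (T v) i.castSucc = ∑ u, (sharedPoly T i).eval (α u) := by
  simp only [localLhs, Fin.lastCases_castSucc, ← sum_localEval]
  exact Finset.sum_comm

theorem sum_localLhs_last :
    ∑ v, localLhs α (I.localInput v) (T v) (Fin.last k) =
      ∏ p ∈ pairs k, (T I.root).claim p.2 p.1 := by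
  simp only [localLhs, Fin.lastCases_last]
  exact sum_ite_root I fun v => ∏ p ∈ pairs k, (T v).claim p.2 p.1

theorem sum_localRhs_zero :
    ∑ v, localRhs H (I.localInput v) (T v) 0 = ((Nat.card (H ≃g H) * I.target : ℕ) : F) :=
  sum_ite_root I fun _ => ((Nat.card (H ≃g H) * I.target : ℕ) : F)

variable {T}

theorem sum_localRhs_succ {r : Fin k → F} (hr : ∀ v, (T v).challenge = r) (i : Fin k) :
    ∑ v, localRhs H (I.localInput v) (T v) i.succ = (sharedPoly T i).eval (r i) := by
  simp only [localRhs, Fin.cases_succ, hr, ← sum_localEval]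
  rfl

theorem sum_localPairCheck {r : Fin k → F} (hr : ∀ v, (T v).challenge = r) (a b : Fin k) :
    ∑ v, localPairCheck α κ H (I.localInput v) (T v) a b =
      (T I.root).claim b a -
        maskedExtension α (entry F κ H I a b) (∑ v, (T v).maskShare b a) (r a) (r b) := by
  simp only [localPairCheck, hr, Finset.sum_sub_distrib, Finset.sum_add_distrib, maskedExtension,
    ← Finset.sum_mul, sum_ite_root I fun v => (T v).claim b a]
  rfl

variable (T) in
/-- The sum of the contributions of all nodes to a linear check. -/
noncomputable def totalCheck (j : CheckIndex k) : F :=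
  ∑ v, localCheck α κ H (I.localInput v) (T v) j

theorem totalCheck_inl (i : Fin (k + 1)) :
    totalCheck α κ H I T (.inl i) =
      ∑ v, localLhs α (I.localInput v) (T v) i - ∑ v, localRhs H (I.localInput v) (T v) i :=
  Finset.sum_sub_distrib _ _

theorem sum_localComb (σ : F) :
    ∑ v, localComb α κ H (I.localInput v) (T v) σ =
      (sparsePoly checkExp (totalCheck α κ H I T)).eval σ := by
  simp only [localComb, eval_sparsePoly, totalCheck, Finset.sum_mul]
  exact Finset.sum_comm

/-- The polynomial that an honest prover, bound to the masks with the shares `N`, shares in the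
round `i`. -/
noncomputable def trueRoundPoly (N : Fin n → Fin k → Fin k → F) (i : Fin k) (r : Fin k → F) :
    F[X] :=
  roundPoly α ((k - 1) * Fintype.card (Fin n))
    (maskedPattern α (entry F κ H I) fun a b => ∑ v, N v b a) i r

end Checks

section CheatingProver

variable {α : Fin n → F} {κ : CopyKind} {H : SimpleGraph (Fin k)} {I : Instance n}

theorem partialSum_maskedPattern_entry (hα : Injective α) (ρ : Fin k → Fin k → F)
    (r : Fin k → F) : partialSum α (maskedPattern α (entry F κ H I) ρ) 0 r =
      ((Nat.card (H ≃g H) * numCopies κ H I.graph : ℕ) : F) := by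
  rw [partialSum_zero, ← sum_prod_entry F κ H I]
  simp only [maskedPattern, maskedExtension_node hα]

theorem natCast_card_aut_mul_target_ne
    (hcast : Set.InjOn (Nat.cast : ℕ → F) (Set.Iic (n ^ k)))
    (hI : numCopies κ H I.graph ≠ I.target) (htarget : Nat.card (H ≃g H) * I.target ≤ n ^ k) :
    ((Nat.card (H ≃g H) * I.target : ℕ) : F) ≠
      ((Nat.card (H ≃g H) * numCopies κ H I.graph : ℕ) : F) := by
  intro h
  have : Finite (H ≃g H) := DFunLike.finite _
  exact hI (Nat.eq_of_mul_eq_mul_left Nat.card_pos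
    (hcast htarget (card_aut_mul_numCopies_le κ H I.graph) h)).symm

theorem exists_bad_round_of_totalCheck_eq_zero (hα : Injective α) (hn : (n : F) ≠ 0)
    (hcast : Set.InjOn (Nat.cast : ℕ → F) (Set.Iic (n ^ k)))
    (hI : numCopies κ H I.graph ≠ I.target) (htarget : Nat.card (H ≃g H) * I.target ≤ n ^ k)
    {T : Fin n → Tables k F} {r : Fin k → F} (hr : ∀ v, (T v).challenge = r)
    (hT : totalCheck α κ H I T = 0) :
    ∃ i, sharedPoly T i ≠ trueRoundPoly α κ H I (fun v => (T v).maskShare) i r ∧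
      (sharedPoly T i).eval (r i) =
        (trueRoundPoly α κ H I (fun v => (T v).maskShare) i r).eval (r i) := by
  have hround (i : Fin (k + 1)) : ∑ v, localLhs α (I.localInput v) (T v) i =
      ∑ v, localRhs H (I.localInput v) (T v) i :=
    sub_eq_zero.1 ((totalCheck_inl α κ H I i).symm.trans (congrFun hT _))
  have hpair (p) (hp : p ∈ pairs k) : (T I.root).claim p.2 p.1 =
      maskedExtension α (entry F κ H I p.1 p.2) (∑ v, (T v).maskShare p.2 p.1) (r p.1) (r p.2) :=
    sub_eq_zero.1 ((sum_localPairCheck α κ H I hr p.1 p.2).symm.trans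
      (congrFun hT (.inr ⟨p, hp⟩)))
  refine exists_bad_round (by simpa using hn) (polynomialInEach_maskedPattern hα _ _) r
    (sharedPoly T) (fun m => ∑ v, localRhs H (I.localInput v) (T v) m)
    (sum_localRhs_succ H I hr) (fun i => ?_) ?_ ?_
  · rw [← sum_localLhs_castSucc, hround]
  · rw [← hround, sum_localLhs_last]
    exact (Finset.prod_congr rfl hpair).symm
  · rw [partialSum_maskedPattern_entry hα, sum_localRhs_zero]
    exact natCast_card_aut_mul_target_ne hcast hI htarget

/-- The prover is lucky in the round `i`: the polynomial shared by the nodes is wrong, but has the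
right value at the challenge. -/
def BadSumRound (κ : CopyKind) (H : SimpleGraph (Fin k)) (I : Instance n)
    (W : (Fin (2 * k + 1) → Challenge α) → Fin (2 * k + 1 + 1) → Fin n → Msg k F) (i : Fin k)
    (c : Fin (2 * k + 1) → Challenge α) : Prop :=
  sharedPoly (tablesOf (W c)) i ≠
      trueRoundPoly α κ H I (fun v => (tablesOf (W c) v).maskShare) i (sumChallenges c) ∧
    (sharedPoly (tablesOf (W c)) i).eval (c (sumTime i)).1 =
      (trueRoundPoly α κ H I (fun v => (tablesOf (W c) v).maskShare) i (sumChallenges c)).eval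
        (c (sumTime i)).1

/-- The challenges reported to the node `v` are wrong, but have the right fingerprint. -/
def BadFingerprint (W : (Fin (2 * k + 1) → Challenge α) → Fin (2 * k + 1 + 1) → Fin n → Msg k F)
    (v : Fin n) (c : Fin (2 * k + 1) → Challenge α) : Prop :=
  sparsePoly Fin.val (tablesOf (W c) v).challenge ≠ sparsePoly Fin.val (sumChallenges c) ∧
    (sparsePoly Fin.val (tablesOf (W c) v).challenge).eval (c (Fin.last _)).1 =
      (sparsePoly Fin.val (sumChallenges c)).eval (c (Fin.last _)).1

/-- Some linear check fails, but the masked random combination of all checks holds. -/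
def BadCombination (κ : CopyKind) (H : SimpleGraph (Fin k)) (I : Instance n)
    (W : (Fin (2 * k + 1) → Challenge α) → Fin (2 * k + 1 + 1) → Fin n → Msg k F)
    (c : Fin (2 * k + 1) → Challenge α) : Prop :=
  sparsePoly checkExp (totalCheck α κ H I (tablesOf (W c))) ≠
      C ((W c 0 I.root).maskTotal - ∑ v, (W c 0 v).mask) ∧
    (sparsePoly checkExp (totalCheck α κ H I (tablesOf (W c)))).eval (c (Fin.last _)).1 =
      (C ((W c 0 I.root).maskTotal - ∑ v, (W c 0 v).mask)).eval (c (Fin.last _)).1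

theorem sparsePoly_checkExp_eq_C {a : CheckIndex k → F} {x : F}
    (h : sparsePoly checkExp a = C x) : a = 0 := by
  funext j
  rw [← coeff_sparsePoly checkExp_injective a, h, coeff_C, if_neg (by simp [checkExp])]
  rfl

theorem bad_of_allAccept (hα : Injective α) (hn : (n : F) ≠ 0)
    (hcast : Set.InjOn (Nat.cast : ℕ → F) (Set.Iic (n ^ k)))
    (hI : numCopies κ H I.graph ≠ I.target)
    {W : (Fin (2 * k + 1) → Challenge α) → Fin (2 * k + 1 + 1) → Fin n → Msg k F}
    {o : Fin n → Fin (2 * k + 1) → Challenge α} {c : Fin (2 * k + 1) → Challenge α}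
    (h : (protocol α κ H).AllAccept I (update o I.root c) (W c)) :
    ((∃ i, BadSumRound κ H I W i c) ∨ ∃ v, BadFingerprint W v c) ∨ BadCombination κ H I W c := by
  by_contra! hgood
  obtain ⟨⟨hsum, hfingerprint⟩, hcombination⟩ := hgood
  have hr (v : Fin n) : (tablesOf (W c) v).challenge = sumChallenges c := by
    by_contra hne
    have heval := (echo_eq_and_fingerprint_eq_of_allAccept h v).2
    rw [update_self] at heval
    exact hfingerprint v ⟨(sparsePoly_injective Fin.val_injective).ne hne, heval⟩
  have hT : totalCheck α κ H I (tablesOf (W c)) = 0 := by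
    by_contra hne
    have htotal := sum_localComb_of_allAccept h
    rw [update_self, Finset.sum_add_distrib, sum_localComb] at htotal
    exact hcombination ⟨fun hC => hne (sparsePoly_checkExp_eq_C hC),
      (eq_sub_of_add_eq htotal).trans eval_C.symm⟩
  obtain ⟨i, hi⟩ :=
    exists_bad_round_of_totalCheck_eq_zero hα hn hcast hI (h I.root).target_le hr hT
  exact hsum i hi

section Probability

variable [Fintype (Challenge α)] [Nonempty (Challenge α)]
  {W : (Fin (2 * k + 1) → Challenge α) → Fin (2 * k + 1 + 1) → Fin n → Msg k F}
  (hW : NonAnticipating W)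
include hW

theorem prob_badSumRound_le (hα : Injective α) (i : Fin k) :
    prob (BadSumRound κ H I W i) ≤ (k * n : ℕ) / Fintype.card (Challenge α) := by
  have hle {s : Fin (2 * k + 1 + 1)} (hs : s ≤ (sumTime i).castSucc) := hW.update hs
  refine prob_eval_eq_eval_update_le (fun _ => natDegree_sparsePoly_le coefExp_le _)
    (fun c => (natDegree_roundPoly_le (polynomialInEach_maskedPattern hα _ _) _ _).trans ?_)
    (sumTime i) (fun c x => ?_) (fun c x => ?_)
  · rw [Fintype.card_fin]
    exact Nat.mul_le_mul_right _ (Nat.sub_le _ _)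
  · simp only [tablesOf, readTables, hle le_rfl]
  · have hmask : (fun v => (tablesOf (W (update c (sumTime i) x)) v).maskShare) =
        fun v => (tablesOf (W c) v).maskShare := by
      have hb (b : Fin k) : (maskTime b).castSucc ≤ (sumTime i).castSucc := by
        simp [maskTime, sumTime, Fin.le_def]; lia
      simp only [tablesOf, readTables, hle (hb _)]
    rw [hmask]
    exact roundPoly_congr fun j hj => sumChallenges_update (sumTime_injective.ne hj.ne)

theorem prob_badFingerprint_le (v : Fin n) :
    prob (BadFingerprint W v) ≤ k / Fintype.card (Challenge α) :=
  prob_eval_eq_eval_update_le (fun _ => natDegree_sparsePoly_le (fun i => i.isLt.le) _)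
    (fun _ => natDegree_sparsePoly_le (fun i => i.isLt.le) _) (Fin.last _)
    (fun c x => by rw [tablesOf_update_last hW])
    (fun c x => by rw [sumChallenges_update_last])

theorem prob_badCombination_le :
    prob (BadCombination κ H I W) ≤ ((k + 1) ^ 2 : ℕ) / Fintype.card (Challenge α) :=
  prob_eval_eq_eval_update_le (fun _ => natDegree_sparsePoly_le checkExp_le _)
    (fun _ => (natDegree_C _).trans_le (Nat.zero_le _)) (Fin.last _)
    (fun c x => by rw [tablesOf_update_last hW])
    (fun c x => by rw [hW.update (Fin.zero_le _)])

theorem prob_allAccept_le (hα : Injective α) (hn : (n : F) ≠ 0)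
    (hcast : Set.InjOn (Nat.cast : ℕ → F) (Set.Iic (n ^ k)))
    (hI : numCopies κ H I.graph ≠ I.target) (o : Fin n → Fin (2 * k + 1) → Challenge α) :
    prob (fun c => (protocol α κ H).AllAccept I (update o I.root c) (W c)) ≤
      (k * (k * n) + n * k + (k + 1) ^ 2 : ℕ) / Fintype.card (Challenge α) := by
  calc
    _ ≤ prob fun c => ((∃ i, BadSumRound κ H I W i c) ∨ ∃ v, BadFingerprint W v c) ∨
          BadCombination κ H I W c :=
      prob_mono fun c => bad_of_allAccept hα hn hcast hI
    _ ≤ ∑ i, prob (BadSumRound κ H I W i) + ∑ v, prob (BadFingerprint W v) +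
          prob (BadCombination κ H I W) :=
      (prob_or_le _ _).trans (add_le_add_left ((prob_or_le _ _).trans
        (add_le_add (prob_exists_le _) (prob_exists_le _))) _)
    _ ≤ ∑ _i : Fin k, ((k * n : ℕ) : ℝ) / Fintype.card (Challenge α) +
          ∑ _v : Fin n, (k : ℝ) / Fintype.card (Challenge α) +
          ((k + 1) ^ 2 : ℕ) / Fintype.card (Challenge α) :=
      add_le_add (add_le_add (Finset.sum_le_sum fun i _ => prob_badSumRound_le hW hα i)
        (Finset.sum_le_sum fun v _ => prob_badFingerprint_le hW v)) (prob_badCombination_le hW)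
    _ = _ := by
      simp only [Finset.sum_const, Finset.card_univ, Fintype.card_fin, nsmul_eq_mul]
      push_cast
      ring

end Probability

end CheatingProver

/-! ### The honest prover -/

theorem extend_congr {ι β γ : Type*} {f : ι → β} {g g' : ι → γ} {e : β → γ} {b : β}
    (h : ∀ a, f a = b → g a = g' a) : extend f g e b = extend f g' e b := by
  classical
  by_cases hb : ∃ a, f a = b
  · rw [extend_def, extend_def, dif_pos hb, dif_pos hb, h _ hb.choose_spec]
  · rw [extend_apply' _ _ _ hb, extend_apply' _ _ _ hb]

/-- The coins of the honest prover: the shares of coefficients that the nodes hold for themselves,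
the shares of the masks, and the masks for the final summation. -/
structure ProverCoin (n k : ℕ) (F : Type) where
  share : Fin n → Fin k → Fin k → F
  maskShare : Fin n → Fin k → Fin k → F
  sumMask : Fin n → F

instance {n k : ℕ} {F : Type} [Nonempty F] : Nonempty (ProverCoin n k F) :=
  ‹Nonempty F›.map fun x => ⟨fun _ _ _ => x, fun _ _ _ => x, fun _ => x⟩

instance {n k : ℕ} {F : Type} [Fintype F] : Fintype (ProverCoin n k F) :=
  Fintype.ofEquiv
    ((Fin n → Fin k → Fin k → F) × (Fin n → Fin k → Fin k → F) × (Fin n → F))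
    { toFun := fun p => ⟨p.1, p.2.1, p.2.2⟩
      invFun := fun pc => (pc.share, pc.maskShare, pc.sumMask)
      left_inv := fun _ => rfl
      right_inv := fun _ => rfl }

section HonestProver

variable {F : Type} [Field F] {n k : ℕ} {α : Fin n → F}

/-- The messages that transmit the given tables, challenges, masks and subtree sum. -/
noncomputable def transmit (T : Tables k F) (c : Fin (2 * k + 1) → Challenge α) (z ζ s : F)
    (t : Fin (2 * k + 1 + 1)) : Msg k F where
  ownShare := extend (fun i => (sumTime i).castSucc) T.ownShare 0 t
  nextShare := extend (fun i => (sumTime i).castSucc) T.nextShare 0 t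
  maskShare := extend (fun b => (maskTime b).castSucc) T.maskShare 0 t
  claim := extend (fun b => (sumTime b).succ) T.claim 0 t
  echo := (Fin.cons 0 fun j => (c j).1 : Fin (2 * k + 1 + 1) → F) t
  mask := z
  maskTotal := ζ
  subtreeSum := (Pi.single (Fin.last _) s : Fin (2 * k + 1 + 1) → F) t

theorem readTables_transmit (T : Tables k F) (c : Fin (2 * k + 1) → Challenge α) (z ζ s : F) :
    readTables (transmit T c z ζ s) = { T with challenge := sumChallenges c } := by
  have hsum := (Fin.castSucc_injective (2 * k + 1)).comp (sumTime_injective (k := k))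
  have hclaim := (Fin.succ_injective (2 * k + 1)).comp (sumTime_injective (k := k))
  have hmask := (Fin.castSucc_injective (2 * k + 1)).comp (maskTime_injective (k := k))
  simp only [readTables, transmit, Fin.cons_succ, Tables.mk.injEq]
  exact ⟨funext fun i => hsum.extend_apply _ _ i, funext fun i => hsum.extend_apply _ _ i,
    funext fun b => hmask.extend_apply _ _ b, funext fun b => hclaim.extend_apply _ _ b, rfl⟩

theorem echo_transmit_last (T : Tables k F) (c : Fin (2 * k + 1) → Challenge α) (z ζ s : F) :
    (transmit T c z ζ s (Fin.last _)).echo = lastChallenge c := rfl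

theorem subtreeSum_transmit_last (T : Tables k F) (c : Fin (2 * k + 1) → Challenge α)
    (z ζ s : F) : (transmit T c z ζ s (Fin.last _)).subtreeSum = s :=
  Pi.single_eq_same _ _

theorem nodeFingerprint_transmit (T : Tables k F) (c : Fin (2 * k + 1) → Challenge α)
    (z ζ s : F) : nodeFingerprint (transmit T c z ζ s) =
      (sparsePoly Fin.val (sumChallenges c)).eval (lastChallenge c) := by
  rw [nodeFingerprint, readTables_transmit, echo_transmit_last]

section Honest

variable (κ : CopyKind) (H : SimpleGraph (Fin k)) (I : Instance n) (pc : ProverCoin n k F)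
  (c : Fin (2 * k + 1) → Challenge α)

/-- The shares of the coefficients of the node `b` that the prover gives to the node before `b`. -/
noncomputable def honestNextShare (b : Fin n) (i j : Fin k) : F :=
  (trueRoundPoly α κ H I pc.maskShare i (sumChallenges c)).coeff (coefExp (b, j)) - pc.share b i j

/-- The values of the masked extensions at the challenges. Where nothing is claimed the mask itself
is sent, so that all masks can be recovered from the values. -/
noncomputable def honestClaim (b a : Fin k) : F :=
  if a < b then
    maskedExtension α (entry F κ H I a b) (∑ v, pc.maskShare v b a) (sumChallenges c a)
      (sumChallenges c b)
  else ∑ v, pc.maskShare v b a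

/-- The tables of the nodes with the honest prover. -/
noncomputable def honestTables (v : Fin n) : Tables k F where
  ownShare := pc.share v
  nextShare := honestNextShare κ H I pc c (finRotate n v)
  maskShare := pc.maskShare v
  claim := honestClaim κ H I pc c
  challenge := sumChallenges c

/-- The masked subtree sums. -/
noncomputable def honestSums : Fin n → F :=
  treeSum I fun v =>
    localComb α κ H (I.localInput v) (honestTables κ H I pc c v) (lastChallenge c) + pc.sumMask v

/-- The strategy of the honest prover. -/
noncomputable def honestStrategy (t : Fin (2 * k + 1 + 1)) (v : Fin n) : Msg k F :=
  transmit (honestTables κ H I pc c v) c (pc.sumMask v) (∑ u, pc.sumMask u)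
    (honestSums κ H I pc c v) t

theorem nonAnticipating_honestStrategy :
    NonAnticipating (honestStrategy (α := α) κ H I pc) := by
  intro c c' t h
  have hchallenge (i : Fin k) (hi : (sumTime i).castSucc < t) :
      sumChallenges c i = sumChallenges c' i := congrArg Subtype.val (h _ hi)
  have hlt {i j : Fin k} (hij : i < j) : (sumTime i).castSucc < (sumTime j).castSucc := by
    simpa [sumTime] using hij
  funext v
  refine (Msg.mk.injEq ..).mpr
    ⟨rfl, extend_congr fun i hi => ?_, rfl, extend_congr fun b hb => ?_, ?_, rfl, rfl, ?_⟩
  · funext j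
    simp only [honestTables, honestNextShare, trueRoundPoly]
    rw [roundPoly_congr fun j hj => hchallenge j (hi ▸ hlt hj)]
  · have hb' : (sumTime b).castSucc < t := hb ▸ Fin.castSucc_lt_succ
    funext a
    refine ite_congr rfl (fun hab => ?_) fun _ => rfl
    rw [hchallenge a ((hlt hab).trans hb'), hchallenge b hb']
  · cases t using Fin.cases with
    | zero => rfl
    | succ j => exact congrArg Subtype.val (h j Fin.castSucc_lt_succ)
  · rcases eq_or_ne t (Fin.last _) with rfl | ht
    · rw [funext fun j => h j j.castSucc_lt_last]
    · simp only [Pi.single_eq_of_ne ht]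

variable {κ H I}

theorem honestSums_eq : honestSums κ H I pc c =
    (fun v => localComb α κ H (I.localInput v) (honestTables κ H I pc c v) (lastChallenge c) +
      pc.sumMask v) + childSum I (honestSums κ H I pc c) :=
  treeSum_eq _ _

variable (hα : Injective α)
include hα

theorem sharedPoly_honestTables (i : Fin k) :
    sharedPoly (honestTables κ H I pc c) i =
      trueRoundPoly α κ H I pc.maskShare i (sumChallenges c) := by
  have hdegree :
      (trueRoundPoly α κ H I pc.maskShare i (sumChallenges c)).natDegree < k * n := by
    refine (natDegree_roundPoly_le (polynomialInEach_maskedPattern hα _ _) _ _).trans_lt ?_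
    rw [Fintype.card_fin]
    exact Nat.mul_lt_mul_of_pos_right (Nat.sub_lt (Fin.pos i) one_pos) I.pos
  rw [← sparsePoly_coeff (e := coefExp (n := n) (k := k)) coefExp_injective fun m hm =>
    coeff_eq_zero_of_natDegree_lt (hdegree.trans_le (not_lt.1 (mt mem_range_coefExp hm)))]
  simp only [sharedPoly, honestTables, honestNextShare, Equiv.apply_symm_apply, Prod.mk.eta,
    add_sub_cancel]

variable (hn : (n : F) ≠ 0) (hI : numCopies κ H I.graph = I.target)
include hn hI

theorem totalCheck_honestTables : totalCheck α κ H I (honestTables κ H I pc c) = 0 := by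
  have hf := polynomialInEach_maskedPattern hα (entry F κ H I)
    fun a b => ∑ v, pc.maskShare v b a
  have hcard : (Fintype.card (Fin n) : F) ≠ 0 := by simpa using hn
  funext j
  rcases j with i | ⟨⟨a, b⟩, hab⟩
  · suffices ∑ v, localLhs α (I.localInput v) (honestTables κ H I pc c v) i =
        partialSum α (maskedPattern α (entry F κ H I) fun a b => ∑ v, pc.maskShare v b a) i
          (sumChallenges c) ∧
      ∑ v, localRhs H (I.localInput v) (honestTables κ H I pc c v) i =
        partialSum α (maskedPattern α (entry F κ H I) fun a b => ∑ v, pc.maskShare v b a) i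
          (sumChallenges c) by
      rw [totalCheck_inl, this.1, this.2, sub_self, Pi.zero_apply]
    constructor
    · cases i using Fin.lastCases with
      | last =>
        rw [sum_localLhs_last, Fin.val_last, partialSum_last hcard]
        exact Finset.prod_congr rfl fun p hp => if_pos (mem_pairs.1 hp)
      | cast i =>
        rw [sum_localLhs_castSucc, sharedPoly_honestTables pc c hα]
        exact sum_eval_roundPoly hf i _ hcard
    · cases i using Fin.cases with
      | zero =>
        rw [sum_localRhs_zero, ← hI]
        exact (partialSum_maskedPattern_entry hα _ _).symm
      | succ i =>
        rw [sum_localRhs_succ H I (T := honestTables κ H I pc c) fun _ => rfl,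
          sharedPoly_honestTables pc c hα]
        exact eval_roundPoly_self hf i (sumChallenges c)
  · exact (sum_localPairCheck α κ H I (T := honestTables κ H I pc c) (fun _ => rfl) a b).trans
      (sub_eq_zero.2 (if_pos (mem_pairs.1 hab)))

theorem honestSums_root : honestSums κ H I pc c I.root = ∑ v, pc.sumMask v := by
  rw [honestSums, treeSum_root, Finset.sum_add_distrib, sum_localComb,
    totalCheck_honestTables pc c hα hn hI]
  simp [eval_sparsePoly]

theorem protocol_complete (coins : Fin n → Fin (2 * k + 1) → Challenge α) :
    (protocol α κ H).AllAccept I coins (honestStrategy κ H I pc (coins I.root)) := by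
  intro v
  have hT : readTables (honestStrategy κ H I pc (coins I.root) · v) =
      honestTables κ H I pc (coins I.root) v :=
    readTables_transmit _ _ _ _ _
  exact
    { target_le := (congrArg _ hI.symm).trans_le (card_aut_mul_numCopies_le κ H I.graph)
      root_challenge := fun hv => by rw [hT, (I.val_eq_zero_iff v).1 hv]; rfl
      root_last := fun hv => by rw [(I.val_eq_zero_iff v).1 hv]; rfl
      root_sum := fun hv => by
        rw [(I.val_eq_zero_iff v).1 hv]
        exact (subtreeSum_transmit_last _ _ _ _ _).trans (honestSums_root pc _ hα hn hI)
      neighbor := fun u m hm => by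
        obtain ⟨-, hm⟩ := Option.ite_none_right_eq_some.1 hm
        rw [← Option.some.inj hm]
        exact ⟨rfl, (nodeFingerprint_transmit _ _ _ _ _).trans
          (nodeFingerprint_transmit _ _ _ _ _).symm⟩
      subtreeSum_eq := by
        rw [sum_deliver_protocol, hT]
        simp only [honestStrategy, subtreeSum_transmit_last]
        exact congrFun (honestSums_eq pc _) v }

end Honest

end HonestProver

/-! ### Zero knowledge -/

section Update

variable {ι β : Type*} [DecidableEq ι] {f g : ι → β} {i : ι} {x y : β}

theorem eq_of_update_eq (h : update f i x = update g i y) (hi : f i = g i) : f = g := by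
  rw [← update_eq_self i f, ← update_idem x, h, hi, update_idem, update_eq_self]

theorem eq_of_update_eq_of_sum_eq [Fintype ι] [AddCancelCommMonoid β]
    (h : update f i x = update g i y) (hsum : ∑ j, f j = ∑ j, g j) : f = g := by
  have heq (j) (hj : j ∈ ({i}ᶜ : Finset ι)) : f j = g j := by
    have hji : j ≠ i := by simpa using hj
    simpa [hji] using congrFun h j
  rw [Fintype.sum_eq_add_sum_compl i f, Fintype.sum_eq_add_sum_compl i g,
    Finset.sum_congr rfl heq] at hsum
  exact eq_of_update_eq h (add_right_cancel hsum)

end Update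

theorem finRotate_ne_self {n : ℕ} (hn : 2 ≤ n) (v : Fin n) : finRotate n v ≠ v :=
  Equiv.Perm.mem_support.1 (support_finRotate_of_le hn ▸ Finset.mem_univ v)

section ZeroKnowledge

variable {F : Type} [Field F] {n k : ℕ} {α : Fin n → F}

/-- The simulated tables of the node `v`. The coins of the prover for the node after `v`, which `v`
does not see, serve as independent random entries. -/
def simTables (pc : ProverCoin n k F) (c : Fin (2 * k + 1) → Challenge α) (v : Fin n) :
    Tables k F where
  ownShare := pc.share v
  nextShare := pc.share (finRotate n v)
  maskShare := pc.maskShare v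
  claim := pc.maskShare (finRotate n v)
  challenge := sumChallenges c

/-- The simulator. The nodes tell their parents that they are their children. The subtree sums are
random, and the mask of the node is chosen to fit them. -/
noncomputable def localSimulator (κ : CopyKind) (H : SimpleGraph (Fin k)) :
    LocalSimulator n (2 * k + 1) (Challenge α) (Msg k F) (EdgeMsg F) (ProverCoin n k F) where
  send li u := { challenge := 0, fingerprint := 0, subtreeSum := if li.parent = u then 1 else 0 }
  message li inb ω :=
    let root : Fin n := ⟨0, li.id.pos⟩
    let T := simTables ω.2 (ω.1 root) li.id
    transmit T (ω.1 root)
      (ω.2.sumMask li.id - localComb α κ H li T (lastChallenge (ω.1 root)) -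
        ∑ u, (inb u).elim 0 fun m => m.subtreeSum * ω.2.sumMask u)
      (ω.2.sumMask root) (ω.2.sumMask li.id)
  receive li inb ω u := (inb u).map fun m =>
    let c := ω.1 ⟨0, li.id.pos⟩
    { challenge := lastChallenge c
      fingerprint := (sparsePoly Fin.val (sumChallenges c)).eval (lastChallenge c)
      subtreeSum := m.subtreeSum * ω.2.sumMask u }

section Revealed

variable (κ : CopyKind) (H : SimpleGraph (Fin k)) (I : Instance n) (v : Fin n)
  (c : Fin (2 * k + 1) → Challenge α)

/-- The change of variables that turns the coins of the prover into what the node `v` sees. -/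
noncomputable def revealed (pc : ProverCoin n k F) : ProverCoin n k F where
  share := update pc.share (finRotate n v) (honestNextShare κ H I pc c (finRotate n v))
  maskShare := update pc.maskShare (finRotate n v) (honestClaim κ H I pc c)
  sumMask := honestSums κ H I pc c

variable {κ H I}

theorem sum_maskShare_eq_of_honestClaim_eq {pc pc' : ProverCoin n k F}
    (h : honestClaim κ H I pc c = honestClaim κ H I pc' c) :
    ∑ v, pc.maskShare v = ∑ v, pc'.maskShare v := by
  have nodal_ne (i : Fin k) : (Lagrange.nodal Finset.univ α).eval (sumChallenges c i) ≠ 0 :=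
    Lagrange.eval_nodal_not_at_node fun u _ => (c (sumTime i)).2 u
  funext b a
  have hab := congrFun (congrFun h b) a
  simp only [honestClaim] at hab
  simp only [Finset.sum_apply]
  split_ifs at hab with hlt
  · exact mul_right_cancel₀ (mul_ne_zero (nodal_ne a) (nodal_ne b)) (add_left_cancel hab)
  · exact hab

theorem sumMask_eq (pc : ProverCoin n k F) (v : Fin n) :
    pc.sumMask v = honestSums κ H I pc c v -
      localComb α κ H (I.localInput v) (honestTables κ H I pc c v) (lastChallenge c) -
        childSum I (honestSums κ H I pc c) v := by
  have h := congrFun (honestSums_eq (κ := κ) (H := H) (I := I) pc c) v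
  rw [Pi.add_apply] at h
  linear_combination -h

variable (κ H I)

theorem revealed_injective : Injective (revealed κ H I v c) := by
  rintro ⟨share, maskShare, sumMask⟩ ⟨share', maskShare', sumMask'⟩ h
  obtain ⟨hshare, hmaskShare, hsums⟩ := ProverCoin.mk.inj h
  have hclaim := congrFun hmaskShare (finRotate n v)
  rw [update_self, update_self] at hclaim
  obtain rfl : maskShare = maskShare' :=
    eq_of_update_eq_of_sum_eq hmaskShare (sum_maskShare_eq_of_honestClaim_eq c hclaim)
  have hnext := congrFun hshare (finRotate n v)
  rw [update_self, update_self] at hnext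
  obtain rfl : share = share' :=
    eq_of_update_eq hshare (funext₂ fun i j => sub_right_injective (congrFun₂ hnext i j))
  obtain rfl : sumMask = sumMask' := funext fun u =>
    ((sumMask_eq c ⟨share, maskShare, sumMask⟩ u).trans (by rw [hsums]; rfl)).trans
      (sumMask_eq c ⟨share, maskShare, sumMask'⟩ u).symm
  rfl

theorem simTables_revealed (hn : 2 ≤ n) (pc : ProverCoin n k F) :
    simTables (revealed κ H I v c pc) c v = honestTables κ H I pc c v := by
  simp only [simTables, revealed, honestTables, update_self,
    update_of_ne (finRotate_ne_self hn v).symm]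

end Revealed

section Simulation

variable {κ : CopyKind} {H : SimpleGraph (Fin k)} {I : Instance n} {v : Fin n}
  (ω : (Fin n → Fin (2 * k + 1) → Challenge α) × ProverCoin n k F)

theorem elim_received_localSimulator (u : Fin n) (s : Fin n → F) :
    (((localSimulator (α := α) κ H).received I v u).elim 0 fun m => m.subtreeSum * s u) =
      if u ≠ I.root ∧ I.parent u = v then s u else 0 :=
  elim_deliver I _ (by simp [localSimulator, Instance.localInput])

theorem message_localSimulator_revealed (hα : Injective α) (hcast : (n : F) ≠ 0) (hn : 2 ≤ n)
    (hI : numCopies κ H I.graph = I.target) :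
    (localSimulator κ H).message (I.localInput v) ((localSimulator (α := α) κ H).received I v)
        (ω.1, revealed κ H I v (ω.1 I.root) ω.2) =
      fun t => honestStrategy κ H I ω.2 (ω.1 I.root) t v := by
  change transmit (simTables (revealed κ H I v (ω.1 I.root) ω.2) (ω.1 I.root) v) (ω.1 I.root)
    (honestSums κ H I ω.2 (ω.1 I.root) v - localComb α κ H (I.localInput v)
      (simTables (revealed κ H I v (ω.1 I.root) ω.2) (ω.1 I.root) v)
        (lastChallenge (ω.1 I.root)) -
        ∑ u, (((localSimulator (α := α) κ H).received I v u).elim 0 fun m =>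
          m.subtreeSum * honestSums κ H I ω.2 (ω.1 I.root) u))
    (honestSums κ H I ω.2 (ω.1 I.root) I.root) (honestSums κ H I ω.2 (ω.1 I.root) v) = _
  simp only [elim_received_localSimulator, ← childSum_apply]
  rw [simTables_revealed κ H I v _ hn, ← sumMask_eq, honestSums_root _ _ hα hcast hI]
  rfl

theorem receive_localSimulator_revealed :
    (localSimulator κ H).receive (I.localInput v) ((localSimulator (α := α) κ H).received I v)
        (ω.1, revealed κ H I v (ω.1 I.root) ω.2) =
      deliver I.graph (fun u => (protocol α κ H).send (I.localInput u) (ω.1 u)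
        fun t => honestStrategy κ H I ω.2 (ω.1 I.root) t u) v := by
  funext u
  by_cases huv : I.graph.Adj u v
  · simp only [localSimulator, deliver, protocol, huv, if_true, Option.map_some, ite_mul, one_mul,
      zero_mul, honestStrategy, echo_transmit_last, nodeFingerprint_transmit,
      subtreeSum_transmit_last]
    rfl
  · simp [localSimulator, deliver, huv]

end Simulation

theorem protocol_zeroKnowledge [Fintype F] [Fintype (Challenge α)] [Nonempty (Challenge α)]
    {l B : ℕ} (ℰ : Encodings l B (Challenge α) (Msg k F) (EdgeMsg F)) {κ : CopyKind}
    {H : SimpleGraph (Fin k)} {I : Instance n} (hα : Injective α) (hcast : (n : F) ≠ 0)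
    (hn : 2 ≤ n) (hI : numCopies κ H I.graph = I.target) (v : Fin n) :
    tvDist (((localSimulator κ H).simulator ℰ).out I v)
      (((protocol α κ H).verifier ℰ).view
        (PublicCoin.honest ℰ I.root (honestStrategy κ H I)) I v) = 0 := by
  refine (localSimulator κ H).tvDist_simulator_out_eq_zero ℰ I _ _ _
    (nonAnticipating_honestStrategy κ H I) v
    (fun ω => (ω.1, revealed κ H I v (ω.1 I.root) ω.2))
    (Finite.injective_iff_bijective.1 fun ω ω' h => ?_) (fun _ => rfl)
    (message_localSimulator_revealed · hα hcast hn hI) receive_localSimulator_revealed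
  obtain ⟨hcoins, hpc⟩ := Prod.mk.inj h
  exact Prod.ext hcoins (revealed_injective κ H I v _ (by simpa [hcoins] using hpc))

end ZeroKnowledge

/-! ### Proof systems for counting -/

/-- A distributed interactive proof system on `n`-node networks: a verifier, an honest prover for
every instance, and a simulator, which communicates within the bounds for the verifier. -/
structure ProofSystem (n r l T B : ℕ) where
  verifier : Verifier n r l T B
  prover : Instance n → Prover n l
  simulator : Simulator n T B (View n l B verifier.Coin)

namespace ProofSystem

variable {n r l T B : ℕ}

/-- Completeness and soundness of a proof system for membership in a set of instances. -/
structure Decides (Q : ProofSystem n r l T B) (L : Set (Instance n)) : Prop where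
  complete : ∀ I ∈ L, 2 / 3 ≤ Q.verifier.acceptProb (Q.prover I) I
  sound : ∀ I ∉ L, ∀ P, Q.verifier.acceptProb P I ≤ 1 / 3

/-- Perfect zero knowledge: on the given instances the simulation has exactly the law of the view
of the node. -/
def PerfectZK (Q : ProofSystem n r l T B) (L : Set (Instance n)) : Prop :=
  ∀ I ∈ L, ∀ v, tvDist (Q.simulator.out I v) (Q.verifier.view (Q.prover I) I v) = 0

end ProofSystem

theorem mem_dStatZK {r l B : ℕ → ℕ} {T : ℕ} {L : Language}
    (Q : ∀ n, ProofSystem n (r n) (l n) T (B n)) (hQ : ∀ n, (Q n).Decides (L n))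
    (hzk : ∀ᶠ n in atTop, (Q n).PerfectZK (L n)) : L ∈ DStatZK r l T B := by
  refine ⟨fun n => (Q n).verifier, fun n => (Q n).prover, fun n => (Q n).simulator,
    fun n => (hQ n).complete, fun n => (hQ n).sound, fun c => ?_⟩
  filter_upwards [hzk] with n hn I hI v
  rw [hn I hI v]
  positivity

theorem Instance.natCast_ne_zero {F : Type} [Field F] {n k : ℕ} (I : Instance n) (hk : k ≠ 0)
    (hcast : Set.InjOn (Nat.cast : ℕ → F) (Set.Iic (n ^ k))) : (n : F) ≠ 0 := fun h =>
  I.pos.ne' <| hcast (Nat.le_self_pow hk n) (Nat.zero_le _) (h.trans Nat.cast_zero.symm)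

section CountingSystem

variable {F : Type} [Field F] [Fintype F] {n k l B : ℕ} {α : Fin n → F}
  [Fintype (Challenge α)] [Nonempty (Challenge α)]
  (ℰ : Encodings l B (Challenge α) (Msg k F) (EdgeMsg F)) (κ : CopyKind)
  (H : SimpleGraph (Fin k))

/-- The proof system for counting the copies of `H` given by the protocol. -/
noncomputable def countingSystem : ProofSystem n (2 * (2 * k + 1) + 1) l 1 B where
  verifier := (protocol α κ H).verifier ℰ
  prover I := PublicCoin.honest ℰ I.root (honestStrategy κ H I)
  simulator := (localSimulator κ H).simulator ℰ

variable (hk : k ≠ 0) (hα : Injective α)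
  (hcast : Set.InjOn (Nat.cast : ℕ → F) (Set.Iic (n ^ k)))

include hk hα hcast

theorem countingSystem_decides
    (hcard : 3 * (k * (k * n) + n * k + (k + 1) ^ 2) ≤ Fintype.card (Challenge α)) :
    (countingSystem ℰ κ H).Decides {I | numCopies κ H I.graph = I.target} where
  complete I hI := by
    have hone := PublicCoin.acceptProb_honest _ ℰ I I.root _ (nonAnticipating_honestStrategy κ H I)
      fun pc => protocol_complete pc hα (I.natCast_ne_zero hk hcast) hI
    exact hone ▸ by norm_num
  sound I hI P := by
    refine PublicCoin.acceptProb_le _ ℰ I I.root (fun o W hW =>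
      (prob_allAccept_le hW hα (I.natCast_ne_zero hk hcast) hcast hI o).trans ?_) P
    have hpos : (0 : ℝ) < Fintype.card (Challenge α) := by exact_mod_cast Fintype.card_pos
    rw [div_le_div_iff₀ hpos three_pos, mul_comm, one_mul]
    exact_mod_cast hcard

theorem countingSystem_perfectZK (hn : 2 ≤ n) :
    (countingSystem ℰ κ H).PerfectZK {I | numCopies κ H I.graph = I.target} := fun I hI v =>
  protocol_zeroKnowledge ℰ hα (I.natCast_ne_zero hk hcast) hn hI v

end CountingSystem

/-! ### Choice of the parameters -/

theorem nonempty_embedding_bits {ι β F : Type} [Fintype ι] [Fintype F] {b m : ℕ}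
    (hF : Fintype.card F ≤ 2 ^ b) (hm : Fintype.card ι = m) {f : β → ι → F} (hf : Injective f) :
    Nonempty (β ↪ Bits (m * b)) := by
  classical
  have hcard : Fintype.card (ι → F) ≤ Fintype.card (Bits (m * b)) :=
    calc Fintype.card (ι → F)
      _ = Fintype.card F ^ m := by rw [Fintype.card_fun, hm]
      _ ≤ (2 ^ b) ^ m := Nat.pow_le_pow_left hF m
      _ = Fintype.card (Bits (m * b)) := by simp [← pow_mul, mul_comm b]
  exact (Embedding.nonempty_of_card_le hcard).map (Embedding.trans ⟨f, hf⟩)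

theorem nonempty_encodings {F ι : Type} [Fintype F] {b k : ℕ} (hF : Fintype.card F ≤ 2 ^ b)
    (α : ι → F) :
    Nonempty (Encodings ((4 * k + 4) * b) (3 * b) (Challenge α) (Msg k F) (EdgeMsg F)) := by
  let fields (m : Msg k F) : (Fin 4 × Fin k) ⊕ Fin 4 → F :=
    Sum.elim (fun p => ![m.ownShare, m.nextShare, m.maskShare, m.claim] p.1 p.2)
      ![m.echo, m.mask, m.maskTotal, m.subtreeSum]
  have fields_injective : Injective fields := fun m m' h => by
    have hrow (i : Fin 4) := funext fun j => congrFun h (.inl (i, j))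
    have hscalar (i : Fin 4) := congrFun h (.inr i)
    exact (Msg.mk.injEq ..).mpr ⟨hrow 0, hrow 1, hrow 2, hrow 3, hscalar 0, hscalar 1, hscalar 2,
      hscalar 3⟩
  have edgeFields_injective :
      Injective fun m : EdgeMsg F => ![m.challenge, m.fingerprint, m.subtreeSum] := fun m m' h =>
    (EdgeMsg.mk.injEq ..).mpr ⟨congrFun h 0, congrFun h 1, congrFun h 2⟩
  have const_injective : Injective fun (c : Challenge α) (_ : Fin (4 * k + 4)) => c.1 :=
    fun c c' h => Subtype.ext (congrFun h 0)
  obtain ⟨challenge⟩ := nonempty_embedding_bits hF (Fintype.card_fin _) const_injective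
  obtain ⟨message⟩ := nonempty_embedding_bits hF (m := 4 * k + 4) (by simp) fields_injective
  obtain ⟨edge⟩ := nonempty_embedding_bits hF (Fintype.card_fin _) edgeFields_injective
  exact ⟨⟨challenge, message, edge⟩⟩

/-- The number of bits that encode an element of the field in which the protocol computes. -/
def fieldBits (n k : ℕ) : ℕ := k * Nat.clog 2 (16 * (n + 2))

theorem exists_prime_gt_and_le_two_pow_fieldBits {n k : ℕ} (hk : 2 ≤ k) :
    ∃ p : ℕ, p.Prime ∧ 5 * k ^ 2 * (n + 2) ^ k < p ∧ p ≤ 2 ^ fieldBits n k := by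
  obtain ⟨p, hp, hlt, hle⟩ :=
    Nat.exists_prime_lt_and_le_two_mul (5 * k ^ 2 * (n + 2) ^ k) (by positivity)
  have hten : 10 ≤ 4 ^ k := le_trans (by norm_num) (Nat.pow_le_pow_right four_pos hk)
  refine ⟨p, hp, hlt, hle.trans ?_⟩
  calc 2 * (5 * k ^ 2 * (n + 2) ^ k)
    _ = 10 * k ^ 2 * (n + 2) ^ k := by ring
    _ ≤ 4 ^ k * (2 ^ k) ^ 2 * (n + 2) ^ k := by gcongr; exact Nat.lt_two_pow_self.le
    _ = (16 * (n + 2)) ^ k := by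
      rw [← pow_mul, mul_comm k, pow_mul, ← mul_pow, ← mul_pow]; norm_num
    _ ≤ (2 ^ Nat.clog 2 (16 * (n + 2))) ^ k := by gcongr; exact Nat.le_pow_clog one_lt_two _
    _ = 2 ^ fieldBits n k := by rw [fieldBits, ← pow_mul, mul_comm k]

theorem three_mul_soundness_error_add_le {k : ℕ} (hk : 2 ≤ k) (n : ℕ) :
    3 * (k * (k * n) + n * k + (k + 1) ^ 2) + n ≤ 5 * k ^ 2 * (n + 2) ^ k := by
  have hpow : (n + 2) ^ 2 ≤ (n + 2) ^ k := Nat.pow_le_pow_right (by lia) hk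
  have hsq : 2 * (n + 2) ≤ (n + 2) ^ 2 := by nlinarith
  calc 3 * (k * (k * n) + n * k + (k + 1) ^ 2) + n
    _ ≤ 5 * k ^ 2 * (2 * (n + 2)) := by
      nlinarith [Nat.mul_le_mul_left n (Nat.le_self_pow two_ne_zero k)]
    _ ≤ 5 * k ^ 2 * (n + 2) ^ k := Nat.mul_le_mul_left _ (hsq.trans hpow)

theorem card_le_card_challenge_add {F : Type} [Fintype F] {n : ℕ} (α : Fin n → F)
    [Fintype (Challenge α)] : Fintype.card F ≤ Fintype.card (Challenge α) + n := by
  have surjective : Surjective (Sum.elim Subtype.val α : Challenge α ⊕ Fin n → F) := fun x => by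
    by_cases hx : ∃ v, α v = x
    · obtain ⟨v, hv⟩ := hx
      exact ⟨.inr v, hv⟩
    · exact ⟨.inl ⟨x, fun v hv => hx ⟨v, hv.symm⟩⟩, rfl⟩
  simpa using Fintype.card_le_of_surjective _ surjective

theorem exists_proofSystem (κ : CopyKind) {k : ℕ} (hk : 2 ≤ k) (H : SimpleGraph (Fin k)) (n : ℕ) :
    ∃ Q : ProofSystem n (2 * (2 * k + 1) + 1) ((4 * k + 4) * fieldBits n k) 1 (3 * fieldBits n k),
      Q.Decides {I | numCopies κ H I.graph = I.target} ∧
        (2 ≤ n → Q.PerfectZK {I | numCopies κ H I.graph = I.target}) := by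
  have hk0 : k ≠ 0 := by lia
  obtain ⟨p, hp, hlt, hle⟩ := exists_prime_gt_and_le_two_pow_fieldBits (n := n) hk
  have : Fact p.Prime := ⟨hp⟩
  have hpow : n ^ k < p :=
    calc n ^ k
      _ ≤ (n + 2) ^ k := Nat.pow_le_pow_left (by lia) k
      _ ≤ 5 * k ^ 2 * (n + 2) ^ k := Nat.le_mul_of_pos_left _ (by positivity)
      _ < p := hlt
  have hcast : Set.InjOn (Nat.cast : ℕ → ZMod p) (Set.Iic (n ^ k)) :=
    (CharP.natCast_injOn_Iio (ZMod p) p).mono (Set.Iic_subset_Iio.2 hpow)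
  let α (v : Fin n) : ZMod p := v.val
  have hα : Injective α := fun u v h => Fin.ext <|
    hcast (u.isLt.le.trans (Nat.le_self_pow hk0 n)) (v.isLt.le.trans (Nat.le_self_pow hk0 n)) h
  have hcard := three_mul_soundness_error_add_le hk n
  have hchallenge := card_le_card_challenge_add α
  rw [ZMod.card] at hchallenge
  have : Nonempty (Challenge α) := Fintype.card_pos_iff.1 (by nlinarith)
  obtain ⟨ℰ⟩ := nonempty_encodings (k := k) ((ZMod.card p).trans_le hle) α
  exact ⟨countingSystem ℰ κ H, countingSystem_decides ℰ κ H hk0 hα hcast (by lia),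
    countingSystem_perfectZK ℰ κ H hk0 hα hcast⟩

section Asymptotics

open Real

theorem one_le_log_natCast {n : ℕ} (hn : 3 ≤ n) : 1 ≤ log n := by
  have hn' : (3 : ℝ) ≤ n := by exact_mod_cast hn
  rw [le_log_iff_exp_le (by linarith)]
  linarith [exp_one_lt_d9]

theorem log_natCast_gt {k : ℕ} (hk : 2 ≤ k) : 0.69 < log k := by
  have hk' : (2 : ℝ) ≤ k := by exact_mod_cast hk
  linarith [log_two_gt_d9, log_le_log two_pos hk']

theorem fieldBits_le {n : ℕ} (hn : 3 ≤ n) (k : ℕ) : (fieldBits n k : ℝ) ≤ 7 * (k * log n) := by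
  have hn' : (3 : ℝ) ≤ n := by exact_mod_cast hn
  have hpow : (16 * (n + 2) : ℝ) ≤ (n : ℝ) ^ 4 := by
    nlinarith [pow_le_pow_left₀ (by norm_num) hn' 3]
  have hlogb : logb 2 (16 * (n + 2)) ≤ 6 * log n := by
    rw [logb, div_le_iff₀ (log_pos one_lt_two)]
    calc log (16 * (n + 2))
      _ ≤ log ((n : ℝ) ^ 4) := log_le_log (by positivity) hpow
      _ = 4 * log n := by rw [log_pow]; norm_num
      _ ≤ 6 * log n * log 2 := by nlinarith [log_two_gt_d9, one_le_log_natCast hn]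
  have hclog : (Nat.clog 2 (16 * (n + 2)) : ℝ) ≤ 7 * log n := by
    have hceil := Nat.ceil_lt_add_one (logb_nonneg one_lt_two (by linarith : 1 ≤ 16 * (n + 2 : ℝ)))
    have hcast := natCeil_logb_natCast 2 (16 * (n + 2))
    push_cast at hcast
    rw [hcast] at hceil
    linarith [one_le_log_natCast hn]
  rw [fieldBits, Nat.cast_mul]
  linarith [mul_le_mul_of_nonneg_left hclog k.cast_nonneg]

section Bounds

variable {n k : ℕ} (hn : 3 ≤ n) (hk : 2 ≤ k)
include hn hk

theorem rounds_le : ((2 * (2 * k + 1) + 1 : ℕ) : ℝ) ≤ 100 * (k * log k + log (log n)) := by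
  have hk' : (2 : ℝ) ≤ k := by exact_mod_cast hk
  have hloglog := log_nonneg (one_le_log_natCast hn)
  push_cast
  nlinarith [log_natCast_gt hk]

theorem proverBits_le {q : ℕ} (hq : n ^ k ≤ q) :
    (((4 * k + 4) * fieldBits n k : ℕ) : ℝ) ≤
      100 * (log q ^ 2 / log k + k * log k * log q) := by
  have hk' : (2 : ℝ) ≤ k := by exact_mod_cast hk
  have hlogk := log_natCast_gt hk
  have hlogq : k * log n ≤ log q := by
    rw [← log_pow]
    exact log_le_log (by positivity) (by exact_mod_cast hq)
  have hlogq0 : 0 ≤ log q := log_natCast_nonneg q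
  have hquot : 0 ≤ log q ^ 2 / log k := by positivity
  push_cast
  calc (4 * k + 4 : ℝ) * fieldBits n k
    _ ≤ 6 * k * (7 * log q) :=
      mul_le_mul (by linarith) (by linarith [fieldBits_le hn k]) (Nat.cast_nonneg _) (by positivity)
    _ = 42 * (k * log q) := by ring
    _ ≤ 100 * (log k * (k * log q)) := by nlinarith [mul_nonneg k.cast_nonneg hlogq0]
    _ ≤ 100 * (log q ^ 2 / log k + k * log k * log q) := by linarith

theorem edgeBits_le : ((3 * fieldBits n k : ℕ) : ℝ) ≤ 100 * (k * (log n + log k) ^ 1) := by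
  have hlogn := one_le_log_natCast hn
  have hlogk := log_natCast_gt hk
  have hnk : 0 ≤ k * log n := by positivity
  have hkk : 0 ≤ k * log k := by positivity
  push_cast
  linarith [fieldBits_le hn k]

end Bounds

theorem eventually_rounds_le_log_log {k : ℕ → ℕ} {K : ℕ} (hK : ∀ n, k n ≤ K) :
    ∀ᶠ n : ℕ in atTop, ((2 * (2 * k n + 1) + 1 : ℕ) : ℝ) ≤ 1 * log (log n) := by
  have tendsto_log_log : Tendsto (fun n : ℕ => log (log n)) atTop atTop :=
    tendsto_log_atTop.comp (tendsto_log_atTop.comp tendsto_natCast_atTop_atTop)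
  filter_upwards [tendsto_log_log.eventually_ge_atTop ((2 * (2 * K + 1) + 1 : ℕ) : ℝ)] with n hn
  rw [one_mul]
  exact le_trans (by gcongr; exact hK n) hn

theorem eventually_pow_le_of_bounded {k q : ℕ → ℕ} {K : ℕ} (hK : ∀ n, k n ≤ K)
    (hq : ∀ᶠ n in atTop, n ^ K < q n) : ∀ᶠ n in atTop, n ^ k n ≤ q n := by
  filter_upwards [hq, eventually_ge_atTop 1] with n hn hn1
  exact (Nat.pow_le_pow_right hn1 (hK n)).trans hn.le

end Asymptotics

end DistZK

open DistZK Filter in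
theorem theorem4_general :
    ∃ C T c : ℕ, ∀ (κ : CopyKind) (k : ℕ → ℕ) (H : ∀ n, SimpleGraph (Fin (k n))) (q : ℕ → ℕ),
      (∀ n, 2 ≤ k n) → (∀ᶠ n in atTop, n ^ k n ≤ q n) →
      ∃ r l B : ℕ → ℕ,
        subgraphCounting κ k H ∈ DStatZK r l T B ∧
        (∀ᶠ n : ℕ in atTop,
          (r n : ℝ) ≤ C * (k n * Real.log (k n) + Real.log (Real.log n))) ∧
        (∀ᶠ n : ℕ in atTop,
          (l n : ℝ) ≤ C * (Real.log (q n) ^ 2 / Real.log (k n)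
            + k n * Real.log (k n) * Real.log (q n))) ∧
        (∀ᶠ n : ℕ in atTop,
          (B n : ℝ) ≤ C * (k n * (Real.log n + Real.log (k n)) ^ c)) ∧
        ((∃ K : ℕ, ∀ n, k n ≤ K) →
          ∃ C' : ℝ, ∀ᶠ n : ℕ in atTop, (r n : ℝ) ≤ C' * Real.log (Real.log n)) := by
  refine ⟨100, 1, 1, fun κ k H q hk hq => ?_⟩
  choose Q hQ hzk using fun n => exists_proofSystem κ (hk n) (H n) n
  have hlarge : ∀ᶠ n : ℕ in atTop, 3 ≤ n := eventually_ge_atTop 3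
  refine ⟨_, _, _, mem_dStatZK Q hQ ((eventually_ge_atTop 2).mono hzk),
    hlarge.mono fun n hn => rounds_le hn (hk n),
    (hlarge.and hq).mono fun n hn => proverBits_le hn.1 (hk n) hn.2,
    hlarge.mono fun n hn => edgeBits_le hn (hk n),
    fun ⟨K, hK⟩ => ⟨1, eventually_rounds_le_log_log hK⟩⟩

open DistZK Filter in
theorem theorem4 :
    ∃ C T c : ℕ, ∀ (κ : CopyKind) (k : ℕ → ℕ) (H : ∀ n, SimpleGraph (Fin (k n))) (q : ℕ → ℕ),
      (∀ n, 2 ≤ k n) → (∀ n, (q n).Prime) →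
      (((∃ K : ℕ, ∀ n, k n ≤ K) ∧ ∀ e : ℕ, ∀ᶠ n in atTop, n ^ e < q n) ∨
        (Tendsto k atTop atTop ∧ ∀ᶠ n in atTop, n ^ k n < q n)) →
      ∃ r l B : ℕ → ℕ,
        subgraphCounting κ k H ∈ DStatZK r l T B ∧
        (∀ᶠ n : ℕ in atTop,
          (r n : ℝ) ≤ C * (k n * Real.log (k n) + Real.log (Real.log n))) ∧
        (∀ᶠ n : ℕ in atTop,
          (l n : ℝ) ≤ C * (Real.log (q n) ^ 2 / Real.log (k n)
            + k n * Real.log (k n) * Real.log (q n))) ∧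
        (∀ᶠ n : ℕ in atTop,
          (B n : ℝ) ≤ C * (k n * (Real.log n + Real.log (k n)) ^ c)) ∧
        ((∃ K : ℕ, ∀ n, k n ≤ K) →
          ∃ C' : ℝ, ∀ᶠ n : ℕ in atTop, (r n : ℝ) ≤ C' * Real.log (Real.log n)) := by
  obtain ⟨C, T, c, h⟩ := theorem4_general
  exact ⟨C, T, c, fun κ k H q hk _ hq => h κ k H q hk <|
    hq.elim (fun ⟨⟨_, hK⟩, hq⟩ => eventually_pow_le_of_bounded hK (hq _))
      fun hq => hq.2.mono fun _ => le_of_lt⟩
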